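/- Frobenius' Theorem. Let $M$ be a smooth manifold of dimension $n$ (Hausdorff, second countable, without boundary), and let $\mathcal D$ be a smooth $k$-dimensional distribution on $M$, that is, a choice of a $k$-dimensional linear subspace $\mathcal D_p\subset T_pM$ for every $p\in M$ such that every point of $M$ has an open neighbourhood on which $\mathcal D$ is spanned by $k$ smooth vector fields $X_1,\dots,X_k$. Then the following are equivalent: (1) There exists a flat chart for $\mathcal D$ at every point of $M$: for every $p\in M$ there is a smooth coordinate chart $(U,\phi)$ of $M$ with $p\in U$ such that $\phi(U)=U'\times U''$ for some $U'\subset\mathbf R^k$ and $U''\subset\mathbf R^{n-k}$, and such that at every point of $U$ the subspace $\mathcal D$ is spanned by the first $k$ coordinate vector fields $\frac{\partial}{\partial x^1},\dots,\frac{\partial}{\partial x^k}$. (2) $\mathcal D$ is completely integrable: for every $p\in M$ there is an integral manifold of $\mathcal D$ through $p$, that is, a smooth manifold $N$ (Hausdorff, second countable) with an injective smooth immersion $i\colon N\to M$ such that $p\in i(N)$ and $di_q(T_qN)=\mathcal D_{i(q)}$ for every $q\in N$. (3) $\mathcal D$ is involutive: for any two smooth vector fields $X,Y$ on $M$ with $X_p,Y_p\in\mathcal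 D_p$ for all $p\in M$, the Lie bracket satisfies $[X,Y]_p\in\mathcal D_p$ for all $p\in M$. -/

import Mathlib

open scoped Manifold ContDiff

/-- A `k`-dimensional distribution on an `n`-manifold `M`: a choice of a `k`-dimensional linear
subspace of `T_p M` for every point `p`. -/
structure TangentDistribution (n k : ℕ) (M : Type*) [TopologicalSpace M]
    [ChartedSpace (EuclideanSpace ℝ (Fin n)) M] where
  toFun : (p : M) → Submodule ℝ (TangentSpace (𝓡 n) p)
  finrank_eq : ∀ p : M, Module.finrank ℝ (toFun p) = k

/-- A vector field is smooth on a set `U` if it is smooth on `U` as a map into the tangent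
bundle. -/
def SmoothVectorFieldOn {n : ℕ} {M : Type*} [TopologicalSpace M]
    [ChartedSpace (EuclideanSpace ℝ (Fin n)) M] [IsManifold (𝓡 n) ∞ M]
    (X : (p : M) → TangentSpace (𝓡 n) p) (U : Set M) : Prop :=
  ContMDiffOn (𝓡 n) (𝓡 n).tangent ∞ (fun p ↦ (⟨p, X p⟩ : TangentBundle (𝓡 n) M)) U

/-- The constant vector field `e_i` on `ℝ^n`. -/
noncomputable def stdVectorField {n : ℕ} (i : Fin n) :
    (x : EuclideanSpace ℝ (Fin n)) → TangentSpace (𝓡 n) x :=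
  fun _ ↦ EuclideanSpace.single i (1 : ℝ)

/-- The `i`-th coordinate vector field `∂/∂x^i` of a chart `φ`: the constant vector field `e_i`
on Euclidean space, pulled back along `φ`. It is meaningful on the domain of `φ`. -/
noncomputable def coordVectorField {n : ℕ} {M : Type*} [TopologicalSpace M]
    [ChartedSpace (EuclideanSpace ℝ (Fin n)) M]
    (φ : OpenPartialHomeomorph M (EuclideanSpace ℝ (Fin n))) (i : Fin n) :
    (p : M) → TangentSpace (𝓡 n) p :=
  VectorField.mpullback (𝓡 n) (𝓡 n) φ (stdVectorField i)

namespace TangentDistribution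

universe u

/-- The distribution is smooth: it is locally spanned by `k` smooth vector fields. -/
def IsSmooth {n k : ℕ} {M : Type*} [TopologicalSpace M]
    [ChartedSpace (EuclideanSpace ℝ (Fin n)) M] [IsManifold (𝓡 n) ∞ M]
    (D : TangentDistribution n k M) : Prop :=
  ∀ p : M, ∃ U : Set M, IsOpen U ∧ p ∈ U ∧
    ∃ X : Fin k → (q : M) → TangentSpace (𝓡 n) q,
      (∀ i, SmoothVectorFieldOn (X i) U) ∧
      ∀ q ∈ U, D.toFun q = Submodule.span ℝ (Set.range fun i ↦ X i q)

/-- The distribution is involutive: the Lie bracket of any two smooth vector fields on `M` that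
lie in `D` lies in `D`. -/
def IsInvolutive {n k : ℕ} {M : Type*} [TopologicalSpace M]
    [ChartedSpace (EuclideanSpace ℝ (Fin n)) M] [IsManifold (𝓡 n) ∞ M]
    (D : TangentDistribution n k M) : Prop :=
  ∀ X Y : (p : M) → TangentSpace (𝓡 n) p,
    SmoothVectorFieldOn X Set.univ → SmoothVectorFieldOn Y Set.univ →
    (∀ p, X p ∈ D.toFun p) → (∀ p, Y p ∈ D.toFun p) →
    ∀ p, VectorField.mlieBracket (𝓡 n) X Y p ∈ D.toFun p

/-- `(N, i)` is an integral manifold of `D`: the map `i : N → M` is an injective smooth immersion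
(so that `(N, i)` is an immersed submanifold) and `di_q (T_q N) = D_{i(q)}` for every `q` in `N`.
The dimension `m` of a nonempty `N` is then necessarily `k`. -/
structure IsIntegralManifold {n k m : ℕ} {M : Type*} [TopologicalSpace M]
    [ChartedSpace (EuclideanSpace ℝ (Fin n)) M]
    (D : TangentDistribution n k M) {N : Type*} [TopologicalSpace N]
    [ChartedSpace (EuclideanSpace ℝ (Fin m)) N] (i : N → M) : Prop where
  injective : Function.Injective i
  isImmersion : Manifold.IsImmersion (𝓡 m) (𝓡 n) ∞ i
  range_mfderiv : ∀ q : N, (mfderiv (𝓡 m) (𝓡 n) i q).range = D.toFun (i q)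

/-- The distribution is completely integrable: through every point of `M` there passes an
integral manifold (a smooth manifold, Hausdorff and second countable). As `i` is injective, every
integral manifold has a copy in the universe of `M`. -/
def IsCompletelyIntegrable {n k : ℕ} {M : Type u} [TopologicalSpace M]
    [ChartedSpace (EuclideanSpace ℝ (Fin n)) M] (D : TangentDistribution n k M) : Prop :=
  ∀ p : M, ∃ (m : ℕ) (N : Type u) (_ : TopologicalSpace N) (_ : T2Space N)
    (_ : SecondCountableTopology N) (_ : ChartedSpace (EuclideanSpace ℝ (Fin m)) N)
    (_ : IsManifold (𝓡 m) ∞ N) (i : N → M),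
    D.IsIntegralManifold (m := m) i ∧ p ∈ Set.range i

/-- The smooth chart `φ`, with domain `U = φ.source`, is flat for `D`: its image `φ(U)` is a
product `U' × U''` of a subset `U'` of `ℝ^k` (the first `k` coordinates) and a subset `U''` of
`ℝ^(n-k)` (the others), and on `U` the distribution is spanned by the first `k` coordinate vector
fields. -/
structure IsFlatChart {n k : ℕ} {M : Type*} [TopologicalSpace M]
    [ChartedSpace (EuclideanSpace ℝ (Fin n)) M] (D : TangentDistribution n k M)
    (φ : OpenPartialHomeomorph M (EuclideanSpace ℝ (Fin n))) : Prop where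
  mem_maximalAtlas : φ ∈ IsManifold.maximalAtlas (𝓡 n) ∞ M
  target_eq_prod : ∃ (U' : Set ({j : Fin n // j.val < k} → ℝ))
    (U'' : Set ({j : Fin n // k ≤ j.val} → ℝ)),
    φ.target = {x | (fun j : {j : Fin n // j.val < k} ↦ x j.val) ∈ U' ∧
      (fun j : {j : Fin n // k ≤ j.val} ↦ x j.val) ∈ U''}
  eq_span : ∀ q ∈ φ.source,
    D.toFun q = Submodule.span ℝ
      (Set.range fun j : {j : Fin n // j.val < k} ↦ coordVectorField φ j.val q)

end TangentDistribution

/-! The implications run (1) → (2) → (3) → (1); only the last one needs analysis.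

(1) → (2): the level sets of the last `n - k` flat coordinates are integral manifolds
(`isCompletelyIntegrable_of_isFlatChart`).

(2) → (3): an immersion is linear in suitable charts. Fields lying in `D` are tangent to that linear
piece along the integral manifold, and the bracket of two fields tangent to a linear subspace is
tangent to it (`map_lieBracket_eq_zero_of_eventually`).

(3) → (1): fix a projection `P` onto `E = ℝ^k` that is injective on `D` at the base point, hence at
nearby points. Each `u : E` then lifts to a unique field in `D` with constant `P`-component `u`. The
bracket of two such lifts lies in `D` by involutivity and is killed by `P`, so it vanishes
(`exists_straightening`). Writing `D` as the graph of `A (x, y) : E → F`, this commutation is the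
integrability condition of the total differential equation `∂f/∂x = A (x, f)`. Solutions with `f (0,
y) = y` give the straightening map `(x, y) ↦ (x, f (x, y))`.

The equation is solved along rays `t ↦ t x`. The integral equation for the path is a smooth equation
in the Banach space of continuous paths, so the implicit function theorem gives existence and smooth
dependence together (`exists_solution_of_contDiff`). That the ray solution satisfies the equation in
every direction follows from its variational equation and integrability (`eq_of_variational`). -/

open scoped BoundedContinuousFunction

/-! ### Smooth inverse and implicit function theorems -/

section InverseFunction

variable {V W : Type*} [NormedAddCommGroup V] [NormedSpace ℝ V] [CompleteSpace V]
  [NormedAddCommGroup W] [NormedSpace ℝ W]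

/-- Inverse function theorem: a map that is smooth on an open set restricts, near a point where its
derivative is invertible, to a homeomorphism between open sets with smooth inverse. -/
theorem ContDiffOn.exists_openPartialHomeomorph {f : V → W} {U : Set V} (hf : ContDiffOn ℝ ∞ f U)
    (hU : IsOpen U) {a : V} (ha : a ∈ U) (f' : V ≃L[ℝ] W)
    (hf' : HasFDerivAt f (f' : V →L[ℝ] W) a) :
    ∃ e : OpenPartialHomeomorph V W, (e : V → W) = f ∧ a ∈ e.source ∧ e.source ⊆ U ∧
      ContDiffOn ℝ ∞ e.symm e.target := by
  have hfa : ContDiffAt ℝ ∞ f a := hf.contDiffAt (hU.mem_nhds ha)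
  let e₀ := hfa.toOpenPartialHomeomorph f hf' (by simp)
  have he₀ : (e₀ : V → W) = f := hfa.toOpenPartialHomeomorph_coe hf' (by simp)
  have hcont : ContinuousOn (fderiv ℝ f) U := hf.continuousOn_fderiv_of_isOpen hU (by simp)
  -- The inverse is smooth wherever the derivative of `f` is invertible. This is an open condition;
  -- restricting to it makes the inverse smooth on the whole target.
  let S := U ∩ fderiv ℝ f ⁻¹' Set.range ((↑) : (V ≃L[ℝ] W) → V →L[ℝ] W)
  have hS : IsOpen S := hcont.isOpen_inter_preimage hU ContinuousLinearEquiv.isOpen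
  have haS : a ∈ S := ⟨ha, f', hf'.fderiv.symm⟩
  refine ⟨e₀.restr S, he₀, ?_, ?_, ?_⟩
  · rw [e₀.restr_source' S hS]
    exact ⟨hfa.mem_toOpenPartialHomeomorph_source hf' (by simp), haS⟩
  · rw [e₀.restr_source' S hS]
    exact fun x hx ↦ hx.2.1
  · intro y hy
    have hx := (e₀.restr S).map_target hy
    rw [e₀.restr_source' S hS] at hx
    obtain ⟨-, hxU, g', hg'⟩ := hx
    have hfx : ContDiffAt ℝ ∞ f ((e₀.restr S).symm y) := hf.contDiffAt (hU.mem_nhds hxU)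
    refine ((e₀.restr S).contDiffAt_symm (f₀' := g') hy ?_ ?_).contDiffWithinAt
    · rw [hg']
      have := (hfx.differentiableAt (by simp)).hasFDerivAt
      simpa [he₀] using this
    · simpa [he₀] using hfx

variable [CompleteSpace W]

/-- Implicit function theorem, with a smooth implicit function on a whole neighbourhood. -/
theorem ContDiff.exists_implicitFunction {f : V × W → W} (hf : ContDiff ℝ ∞ f) {a : V} {b : W}
    (hab : f (a, b) = 0)
    (hf' : (fderiv ℝ f (a, b)).comp (ContinuousLinearMap.inr ℝ V W) = ContinuousLinearMap.id ℝ W) :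
    ∃ (U : Set V) (g : V → W), IsOpen U ∧ a ∈ U ∧ ContDiffOn ℝ ∞ g U ∧ g a = b ∧
      (∀ x ∈ U, f (x, g x) = 0) ∧
      ∀ᶠ z in nhds (a, b), f z = 0 → z.2 = g z.1 := by
  -- The zero set of `f` is the preimage of `V × {0}` under `Φ`, so inverting `Φ` parametrizes it
  -- and also gives local uniqueness.
  let Φ : V × W → V × W := fun z ↦ (z.1, f z)
  have hΦ : ContDiff ℝ ∞ Φ := contDiff_fst.prodMk hf
  let L := fderiv ℝ f (a, b)
  have hL (w : W) : L (0, w) = w := by simpa using DFunLike.congr_fun hf' w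
  have hL' (v : V) (w : W) : L (v, w) = L (v, 0) + w := by
    rw [← hL w, ← map_add, hL]; simp
  let Φ' : (V × W) ≃L[ℝ] V × W := ContinuousLinearEquiv.equivOfInverse
    ((ContinuousLinearMap.fst ℝ V W).prod L)
    ((ContinuousLinearMap.fst ℝ V W).prod (ContinuousLinearMap.snd ℝ V W -
      L.comp ((ContinuousLinearMap.inl ℝ V W).comp (ContinuousLinearMap.fst ℝ V W))))
    (by rintro ⟨v, w⟩; simp [hL' v w]) (by rintro ⟨v, w⟩; simp [hL' v (w - _)])
  have hΦ' : HasFDerivAt Φ (Φ' : V × W →L[ℝ] V × W) (a, b) :=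
    hasFDerivAt_fst.prodMk (hf.differentiable (by simp) _).hasFDerivAt
  obtain ⟨e, he, hae, -, hsymm⟩ := hΦ.contDiffOn.exists_openPartialHomeomorph isOpen_univ
    (Set.mem_univ (a, b)) Φ' hΦ'
  have heab : e (a, b) = (a, 0) := by simp [he, Φ, hab]
  have hfst (z : V × W) (hz : z ∈ e.target) : (e.symm z).1 = z.1 ∧ f (e.symm z) = z.2 := by
    have h : ((e.symm z).1, f (e.symm z)) = z :=
      (congrFun he (e.symm z)).symm.trans (e.right_inv hz)
    exact Prod.ext_iff.1 h
  have hι : ContDiff ℝ ∞ (fun x : V ↦ (x, (0 : W))) := contDiff_id.prodMk contDiff_const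
  refine ⟨(fun x : V ↦ (x, (0 : W))) ⁻¹' e.target, fun x ↦ (e.symm (x, 0)).2,
    e.open_target.preimage hι.continuous, ?_, ?_, ?_, ?_, ?_⟩
  · simpa [← heab] using e.map_source hae
  · exact contDiff_snd.comp_contDiffOn (hsymm.comp hι.contDiffOn (fun x hx ↦ hx))
  · simp [← heab, e.left_inv hae]
  · intro x hx
    obtain ⟨h1, h2⟩ := hfst _ hx
    have : ((x, (e.symm (x, 0)).2) : V × W) = e.symm (x, 0) := Prod.ext h1.symm rfl
    rw [this, h2]
  · filter_upwards [e.open_source.mem_nhds hae] with z hz hfz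
    have : e z = (z.1, 0) := by simp [he, Φ, hfz]
    rw [← this, e.left_inv hz]

end InverseFunction

/-! ### Smoothness of superposition operators on path spaces -/

section Superposition

universe u

namespace BoundedContinuousFunction

/-- The constant paths, as a continuous linear map. -/
noncomputable def constL (K V : Type*) [TopologicalSpace K] [NormedAddCommGroup V]
    [NormedSpace ℝ V] : V →L[ℝ] (K →ᵇ V) :=
  LinearMap.mkContinuous
    { toFun := const K
      map_add' := fun _ _ ↦ rfl
      map_smul' := fun _ _ ↦ rfl } 1 (fun x ↦ by rw [one_mul]; exact norm_const_le x)

@[simp] lemma constL_apply {K V : Type*} [TopologicalSpace K] [NormedAddCommGroup V]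
    [NormedSpace ℝ V] (x : V) (t : K) : constL K V x t = x := rfl

variable {K : Type*} [TopologicalSpace K] [CompactSpace K]

/-- Pointwise application of continuous families of continuous linear maps. -/
noncomputable def pointwiseApply (K : Type*) [TopologicalSpace K] [CompactSpace K]
    (V W : Type*) [NormedAddCommGroup V] [NormedSpace ℝ V] [NormedAddCommGroup W]
    [NormedSpace ℝ W] : (K →ᵇ V →L[ℝ] W) →L[ℝ] (K →ᵇ V) →L[ℝ] (K →ᵇ W) :=
  LinearMap.mkContinuous₂
    (LinearMap.mk₂ ℝ (fun (T : K →ᵇ V →L[ℝ] W) (γ : K →ᵇ V) ↦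
      mkOfCompact ⟨fun t ↦ T t (γ t), T.continuous.clm_apply γ.continuous⟩)
      (fun _ _ _ ↦ by ext; simp) (fun _ _ _ ↦ by ext; simp)
      (fun _ _ _ ↦ by ext; simp) (fun _ _ _ ↦ by ext; simp)) 1
    (fun T γ ↦ by
      rw [one_mul, norm_le (by positivity)]
      exact fun t ↦ (T t).le_of_opNorm_le_of_le (T.norm_coe_le_norm t) (γ.norm_coe_le_norm t))

@[simp] lemma pointwiseApply_apply {V W : Type*} [NormedAddCommGroup V] [NormedSpace ℝ V]
    [NormedAddCommGroup W] [NormedSpace ℝ W] (T : K →ᵇ V →L[ℝ] W) (γ : K →ᵇ V) (t : K) :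
    pointwiseApply K V W T γ t = T t (γ t) := rfl

variable {V W : Type u} [NormedAddCommGroup V] [NormedAddCommGroup W]

/-- The superposition operator `γ ↦ v ∘ γ`. -/
noncomputable def superpose {v : V → W} (hv : Continuous v) (γ : K →ᵇ V) : K →ᵇ W :=
  mkOfCompact ⟨fun t ↦ v (γ t), hv.comp γ.continuous⟩

@[simp] lemma superpose_apply {v : V → W} (hv : Continuous v) (γ : K →ᵇ V) (t : K) :
    superpose hv γ t = v (γ t) := rfl

variable [NormedSpace ℝ V] [NormedSpace ℝ W]

/-- On a compact space the sup norm induces the compact-open topology, for which postcomposition is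
continuous. -/
lemma continuous_superpose {v : V → W} (hv : Continuous v) :
    Continuous (superpose (K := K) hv) := by
  let c (V : Type u) [NormedAddCommGroup V] [NormedSpace ℝ V] : C(K, V) ≃ₗᵢ[ℝ] (K →ᵇ V) :=
    ContinuousMap.linearIsometryBoundedOfCompact K V ℝ
  have : superpose (K := K) hv = c W ∘ (fun γ ↦ (⟨v, hv⟩ : C(V, W)).comp γ) ∘ (c V).symm := by
    ext; rfl
  rw [this]
  exact (c W).continuous.comp ((ContinuousMap.continuous_postcomp _).comp (c V).symm.continuous)

/-- The superposition operator `γ ↦ v ∘ γ` of a `C^1` map is differentiable. -/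
theorem hasFDerivAt_superpose {v : V → W} (hv : ContDiff ℝ 1 v) (γ : K →ᵇ V) :
    HasFDerivAt (superpose (K := K) hv.continuous)
      (pointwiseApply K V W (superpose (hv.continuous_fderiv (by simp)) γ)) γ := by
  have hdv := hv.continuous_fderiv (by simp)
  rw [hasFDerivAt_iff_isLittleO_nhds_zero, Asymptotics.isLittleO_iff]
  intro ε hε
  -- Continuity of superposition by the derivative provides one `δ` for all `t`; it is tested below
  -- on the shifts of `γ` by constants.
  obtain ⟨δ, hδ, hδε⟩ := Metric.continuousAt_iff.1
    ((continuous_superpose (K := K) hdv).continuousAt (x := γ)) ε hε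
  filter_upwards [Metric.ball_mem_nhds (0 : K →ᵇ V) hδ] with h hh
  rw [norm_le (by positivity)]
  intro t
  have hder (x : V) : HasFDerivAt v (fderiv ℝ v x) x :=
    (hv.differentiable (by simp) x).hasFDerivAt
  have hbound (x : V) (hx : x ∈ Metric.ball (γ t) δ) :
      ‖fderiv ℝ v x - fderiv ℝ v (γ t)‖ ≤ ε := by
    have := hδε (x := γ + const K (x - γ t)) (by
      rw [dist_eq_norm, add_sub_cancel_left]
      exact (norm_const_le _).trans_lt (by simpa [dist_eq_norm] using hx))
    have h2 := ((dist_coe_le_dist t).trans this.le)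
    simpa [dist_eq_norm] using h2
  have hht : ‖h t‖ < δ := (h.norm_coe_le_norm t).trans_lt (by simpa using hh)
  have := (convex_ball (γ t) δ).norm_image_sub_le_of_norm_hasFDerivWithin_le'
    (fun x _ ↦ (hder x).hasFDerivWithinAt) hbound (Metric.mem_ball_self hδ)
    (y := γ t + h t) (by simpa using hht)
  simp only [add_sub_cancel_left] at this
  calc _ ≤ ε * ‖h t‖ := by simpa using this
    _ ≤ ε * ‖h‖ := by gcongr; exact h.norm_coe_le_norm t

/-- The superposition operator of a `C^m` map is `C^m`. -/
theorem contDiff_superpose_nat (m : ℕ) : ∀ {W : Type u} [NormedAddCommGroup W] [NormedSpace ℝ W]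
    {v : V → W} (hv : ContDiff ℝ m v), ContDiff ℝ m (superpose (K := K) hv.continuous) := by
  -- The target varies in the induction: the derivative is a bounded linear map applied to the
  -- superposition operator of `fderiv ℝ v`, whose values lie in `V →L[ℝ] W`.
  induction m with
  | zero =>
    intro W _ _ v hv
    exact contDiff_zero.2 (continuous_superpose _)
  | succ m ih =>
    intro W _ _ v hv
    have h1 : ContDiff ℝ 1 v := hv.of_le (by simp)
    have hd : ContDiff ℝ m (fderiv ℝ v) := hv.fderiv_right (by simp)
    push_cast
    refine contDiff_succ_iff_hasFDerivAt.2 ⟨_, ?_, fun γ ↦ hasFDerivAt_superpose h1 γ⟩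
    exact (pointwiseApply K V W).contDiff.comp (ih hd)

/-- The superposition operator of a smooth map is smooth. -/
theorem contDiff_superpose {v : V → W} (hv : ContDiff ℝ ∞ v) :
    ContDiff ℝ ∞ (superpose (K := K) hv.continuous) :=
  contDiff_infty.2 fun m ↦ contDiff_superpose_nat m (contDiff_infty.1 hv m)

end BoundedContinuousFunction

end Superposition

/-! ### Primitives of paths -/

section Integration

variable {W : Type*} [NormedAddCommGroup W] [NormedSpace ℝ W]

namespace BoundedContinuousFunction

/-- The primitive of a path, extended constantly to the real line. -/
noncomputable def primitive (h : unitInterval →ᵇ W) (t : ℝ) : W :=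
  ∫ s in (0 : ℝ)..t, h (Set.projIcc 0 1 zero_le_one s)

lemma hasDerivAt_primitive [CompleteSpace W] (h : unitInterval →ᵇ W) (t : ℝ) :
    HasDerivAt h.primitive (h (Set.projIcc 0 1 zero_le_one t)) t := by
  have hc : Continuous fun s : ℝ ↦ h (Set.projIcc 0 1 zero_le_one s) :=
    h.continuous.comp continuous_projIcc
  exact intervalIntegral.integral_hasDerivAt_right (hc.intervalIntegrable _ _)
    hc.stronglyMeasurable.stronglyMeasurableAtFilter hc.continuousAt

@[simp] lemma primitive_zero (h : unitInterval →ᵇ W) : h.primitive 0 = 0 := by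
  simp [primitive]

variable (W) in
/-- The primitive of paths, as a continuous linear operator. -/
noncomputable def primitiveL [CompleteSpace W] : (unitInterval →ᵇ W) →L[ℝ] (unitInterval →ᵇ W) :=
  LinearMap.mkContinuous
    { toFun := fun h ↦ mkOfCompact ⟨fun t ↦ h.primitive t, (continuous_iff_continuousAt.2
        fun t ↦ (h.hasDerivAt_primitive t).continuousAt).comp continuous_subtype_val⟩
      map_add' := fun h₁ h₂ ↦ by
        ext t
        simp only [primitive, mkOfCompact_apply, ContinuousMap.coe_mk, add_apply]
        exact intervalIntegral.integral_add
          ((h₁.continuous.comp continuous_projIcc).intervalIntegrable _ _)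
          ((h₂.continuous.comp continuous_projIcc).intervalIntegrable _ _)
      map_smul' := fun c h ↦ by
        ext t
        simp [primitive, intervalIntegral.integral_smul] } 1
    (fun h ↦ by
      rw [one_mul, norm_le (norm_nonneg _)]
      intro t
      have := intervalIntegral.norm_integral_le_of_norm_le_const (a := 0) (b := (t : ℝ))
        (f := fun s ↦ h (Set.projIcc 0 1 zero_le_one s)) (C := ‖h‖)
        (fun s _ ↦ h.norm_coe_le_norm _)
      refine this.trans ?_
      rw [sub_zero, abs_of_nonneg t.2.1]
      exact mul_le_of_le_one_right (norm_nonneg _) t.2.2)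

@[simp] lemma primitiveL_apply [CompleteSpace W] (h : unitInterval →ᵇ W) (t : unitInterval) :
    primitiveL W h t = h.primitive t := rfl

end BoundedContinuousFunction

end Integration

/-! ### Globalizing smooth maps by cutoff -/

section Cutoff

variable {V W : Type*} [NormedAddCommGroup V] [NormedSpace ℝ V] [FiniteDimensional ℝ V]
  [NormedAddCommGroup W] [NormedSpace ℝ W]

/-- A map that is smooth on an open set agrees, near a point of it, with a globally smooth map. -/
theorem ContDiffOn.exists_contDiff_eventuallyEq {f : V → W} {U : Set V} (hf : ContDiffOn ℝ ∞ f U)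
    (hU : IsOpen U) {a : V} (ha : a ∈ U) : ∃ g : V → W, ContDiff ℝ ∞ g ∧ g =ᶠ[nhds a] f := by
  obtain ⟨ε, hε, hεU⟩ := Metric.isOpen_iff.1 hU a ha
  let χ : ContDiffBump a := ⟨ε / 4, ε / 2, by positivity, by linarith⟩
  refine ⟨fun x ↦ χ x • f x, contDiff_iff_contDiffAt.2 fun x ↦ ?_, ?_⟩
  · by_cases hx : x ∈ tsupport χ
    · rw [χ.tsupport_eq] at hx
      have hxU : x ∈ U := hεU (Metric.closedBall_subset_ball (by simp [χ, hε]) hx)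
      exact χ.contDiffAt.smul (hf.contDiffAt (hU.mem_nhds hxU))
    · have h0 : (fun x ↦ χ x • f x) =ᶠ[nhds x] fun _ ↦ 0 := by
        filter_upwards [(isClosed_tsupport χ).isOpen_compl.mem_nhds hx] with z hz
        simp [image_eq_zero_of_notMem_tsupport hz]
      exact contDiffAt_const.congr_of_eventuallyEq h0
  · filter_upwards [χ.eventuallyEq_one] with x hx
    simp [hx]

end Cutoff

/-! ### Uniqueness for homogeneous linear equations -/

section LinearODE

variable {W : Type*} [NormedAddCommGroup W] [NormedSpace ℝ W]

/-- A solution of a homogeneous linear differential equation that vanishes at time `0` vanishes. -/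
theorem eq_zero_of_hasDerivAt_linear (C : unitInterval →ᵇ W →L[ℝ] W) {η : ℝ → W}
    (hη : ∀ t : unitInterval, HasDerivAt η (C t (η t)) t) (h0 : η 0 = 0) (t : unitInterval) :
    η t = 0 := by
  let v : ℝ → W → W := fun t w ↦ C (Set.projIcc 0 1 zero_le_one t) w
  have hlip (t : ℝ) : LipschitzOnWith ‖C‖₊ (v t) Set.univ :=
    ((C _).lipschitz.weaken (C.norm_coe_le_norm _)).lipschitzOnWith
  have hη' (t : ℝ) (ht : t ∈ Set.Icc (0 : ℝ) 1) : HasDerivAt η (v t (η t)) t := by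
    have := hη ⟨t, ht⟩
    simpa only [v, Set.projIcc_of_mem zero_le_one ht] using this
  refine ODE_solution_unique_of_mem_Icc_right (v := v) (s := fun _ ↦ Set.univ) (K := ‖C‖₊)
    (a := 0) (b := 1) (f := η) (g := fun _ ↦ 0) (fun t _ ↦ hlip t)
    (fun t ht ↦ (hη' t ht).continuousAt.continuousWithinAt)
    (fun t ht ↦ (hη' t ⟨ht.1, ht.2.le⟩).hasDerivWithinAt) (fun _ _ ↦ Set.mem_univ _)
    continuousOn_const (fun t _ ↦ ?_) (fun _ _ ↦ Set.mem_univ _) h0 t.2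
  simpa [v] using hasDerivWithinAt_const t (Set.Ici t) (0 : W)

end LinearODE

/-! ### Integrable total differential equations -/

namespace TotalDifferential

universe u
variable {E F : Type u} [NormedAddCommGroup E] [NormedSpace ℝ E]
  [NormedAddCommGroup F] [NormedSpace ℝ F]

/-- The path `t ↦ (t x, γ t)`. -/
noncomputable def path (E F : Type u) [NormedAddCommGroup E] [NormedSpace ℝ E]
    [NormedAddCommGroup F] [NormedSpace ℝ F] :
    (E × (unitInterval →ᵇ F)) →L[ℝ] (unitInterval →ᵇ E × F) :=
  LinearMap.mkContinuous
    { toFun := fun p ↦ BoundedContinuousFunction.mkOfCompact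
        ⟨fun t ↦ ((t : ℝ) • p.1, p.2 t), by fun_prop⟩
      map_add' := fun p q ↦ by ext t <;> simp
      map_smul' := fun c p ↦ by ext t <;> simp [smul_comm (t : ℝ) c] } 1
    (fun p ↦ by
      rw [one_mul, BoundedContinuousFunction.norm_le (norm_nonneg _)]
      intro t
      refine max_le_max ?_ (p.2.norm_coe_le_norm t)
      change ‖(t : ℝ) • p.1‖ ≤ ‖p.1‖
      rw [norm_smul, Real.norm_eq_abs, abs_of_nonneg t.2.1]
      exact mul_le_of_le_one_left (norm_nonneg _) t.2.2)

@[simp] lemma path_apply (x : E) (γ : (unitInterval →ᵇ F)) (t : unitInterval) :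
    path E F (x, γ) t = ((t : ℝ) • x, γ t) := rfl

variable {A : E × F → E →L[ℝ] F} (hA : ContDiff ℝ ∞ A)

/-- The velocity `t ↦ A (t x, γ t) x`. -/
noncomputable def velocity (p : E × (unitInterval →ᵇ F)) : (unitInterval →ᵇ F) :=
  BoundedContinuousFunction.pointwiseApply unitInterval E F
    (BoundedContinuousFunction.superpose hA.continuous (path E F p))
    (BoundedContinuousFunction.constL unitInterval _ p.1)

@[simp] lemma velocity_apply (x : E) (γ : (unitInterval →ᵇ F)) (t : unitInterval) :
    velocity hA (x, γ) t = A ((t : ℝ) • x, γ t) x := rfl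

lemma contDiff_velocity : ContDiff ℝ ∞ (velocity hA) := by
  have h : ContDiff ℝ ∞ fun p ↦ BoundedContinuousFunction.pointwiseApply unitInterval E F
      (BoundedContinuousFunction.superpose hA.continuous (path E F p)) :=
    (ContinuousLinearMap.contDiff _).comp
      ((BoundedContinuousFunction.contDiff_superpose hA).comp (path E F).contDiff)
  exact h.clm_apply ((ContinuousLinearMap.contDiff _).comp contDiff_fst)

lemma fderiv_velocity_apply (x ξ : E) (γ η : (unitInterval →ᵇ F)) (t : unitInterval) :
    fderiv ℝ (velocity hA) (x, γ) (ξ, η) t =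
      fderiv ℝ A ((t : ℝ) • x, γ t) ((t : ℝ) • ξ, η t) x + A ((t : ℝ) • x, γ t) ξ := by
  have h1 := (BoundedContinuousFunction.hasFDerivAt_superpose (K := unitInterval)
    (hA.of_le (by simp)) (path E F (x, γ))).comp (x, γ) (path E F).hasFDerivAt
  have h2 := (BoundedContinuousFunction.constL unitInterval E).hasFDerivAt.comp (x, γ)
    (hasFDerivAt_fst (𝕜 := ℝ) (E := E) (F := unitInterval →ᵇ F) (p := (x, γ)))
  have h3 := (BoundedContinuousFunction.pointwiseApply unitInterval E F).hasFDerivAt_of_bilinear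
    h1 h2
  have h4 : fderiv ℝ (velocity hA) (x, γ) = _ := h3.fderiv
  rw [h4]
  exact add_comm _ _

variable [CompleteSpace F]

/-- The defect in the integral equation for the solution with initial value `y` along the
segment `t ↦ t x`. -/
noncomputable def defect (p : (E × F) × (unitInterval →ᵇ F)) : (unitInterval →ᵇ F) :=
  p.2 - BoundedContinuousFunction.constL unitInterval _ p.1.2 -
    BoundedContinuousFunction.primitiveL F (velocity hA (p.1.1, p.2))

lemma contDiff_defect : ContDiff ℝ ∞ (defect hA) := by
  refine (contDiff_snd.sub ((ContinuousLinearMap.contDiff _).comp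
    (contDiff_snd.comp contDiff_fst))).sub ((ContinuousLinearMap.contDiff _).comp
      ((contDiff_velocity hA).comp ?_))
  exact (contDiff_fst.comp contDiff_fst).prodMk contDiff_snd

/-- Over `x = 0` the ray is a point and the velocity vanishes. This makes the linearization in the
path variable the identity and identifies the solution with the constant path at `y`. -/
lemma defect_zero_left (y : F) (γ : (unitInterval →ᵇ F)) :
    defect hA ((0, y), γ) = γ - BoundedContinuousFunction.constL unitInterval F y := by
  have : velocity hA (0, γ) = 0 := by ext t; simp
  simp [defect, this]

/-- Variational equation along a solution: the derivative in the initial direction is determined by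
the total differential equation, as soon as the latter is integrable. -/
lemma eq_of_variational {x ξ : E} {y : F} {γ η : (unitInterval →ᵇ F)}
    (hγ : ∀ t, γ t = y + (velocity hA (x, γ)).primitive t)
    (hη : ∀ t, η t = (fderiv ℝ (velocity hA) (x, γ) (ξ, η)).primitive t)
    (hsymm : ∀ t : unitInterval, ∀ u v,
      fderiv ℝ A ((t : ℝ) • x, γ t) (u, A ((t : ℝ) • x, γ t) u) v =
      fderiv ℝ A ((t : ℝ) • x, γ t) (v, A ((t : ℝ) • x, γ t) v) u) :
    η 1 = A (x, γ 1) ξ := by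
  -- `c` and `e` extend `γ` and `η` to the real line, so that two-sided derivatives exist at the
  -- endpoints too.
  let c : ℝ → F := fun t ↦ y + (velocity hA (x, γ)).primitive t
  let e : ℝ → F := fun t ↦ (fderiv ℝ (velocity hA) (x, γ) (ξ, η)).primitive t
  -- The candidate for `η t` is `t • A (t x, γ t) ξ`. In the derivative of the difference `d`,
  -- integrability cancels everything except a term linear in `d`; as `d 0 = 0`, also `d 1 = 0`.
  let d : ℝ → F := fun t ↦ e t - t • A (t • x, c t) ξ
  -- `L B w = B (0, w) x`.
  let L : (E × F →L[ℝ] E →L[ℝ] F) →L[ℝ] F →L[ℝ] F :=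
    (((ContinuousLinearMap.compL ℝ F (E →L[ℝ] F) F)
      (ContinuousLinearMap.apply ℝ F x)).comp
    ((ContinuousLinearMap.compL ℝ F (E × F) (E →L[ℝ] F)).flip (ContinuousLinearMap.inr ℝ E F)))
  let C : unitInterval →ᵇ F →L[ℝ] F :=
    .mkOfCompact ⟨fun t ↦ L (fderiv ℝ A ((t : ℝ) • x, γ t)), L.continuous.comp
      ((hA.continuous_fderiv (by simp)).comp (by fun_prop))⟩
  have hd (t : unitInterval) : HasDerivAt d (C t (d t)) t := by
    have hc : c t = γ t := (hγ t).symm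
    have he : e t = η t := (hη t).symm
    have hc' : HasDerivAt c (A ((t : ℝ) • x, γ t) x) t := by
      have := ((velocity hA (x, γ)).hasDerivAt_primitive t).const_add y
      rw [Set.projIcc_val] at this
      exact this
    have he' : HasDerivAt e (fderiv ℝ A ((t : ℝ) • x, γ t) ((t : ℝ) • ξ, η t) x +
        A ((t : ℝ) • x, γ t) ξ) t := by
      simpa [fderiv_velocity_apply] using
        (fderiv ℝ (velocity hA) (x, γ) (ξ, η)).hasDerivAt_primitive t
    have hline : HasDerivAt (fun s : ℝ ↦ (s • x, c s)) (x, A ((t : ℝ) • x, γ t) x) t := by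
      simpa using ((hasDerivAt_id (t : ℝ)).smul_const x).prodMk hc'
    have hA' : HasDerivAt (fun s : ℝ ↦ A (s • x, c s))
        (fderiv ℝ A ((t : ℝ) • x, c t) (x, A ((t : ℝ) • x, γ t) x)) t :=
      ((hA.differentiable (by simp) _).hasFDerivAt).comp_hasDerivAt (t : ℝ) hline
    have := he'.sub ((hasDerivAt_id (t : ℝ)).smul (hA'.clm_apply (hasDerivAt_const (t : ℝ) ξ)))
    refine this.congr_deriv ?_
    have hs := hsymm t x ξ
    have hsplit (w : E × F) (r : ℝ) (a : E) (b : F) : fderiv ℝ A w (r • a, b) =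
        r • fderiv ℝ A w (a, A w a) + fderiv ℝ A w (0, b - r • A w a) := by
      rw [← map_smul, ← map_add]; simp
    simp [C, L, d, hc, he, hs, hsplit _ (t : ℝ) ξ]
  have := eq_zero_of_hasDerivAt_linear C hd (by simp [d, e]) 1
  have h1 : e 1 = η 1 := by simpa using (hη 1).symm
  have h2 : c 1 = γ 1 := by simpa using (hγ 1).symm
  simpa [d, h1, h2, sub_eq_zero] using this

variable [CompleteSpace E]

/-- Solvability of an integrable total differential equation `∂f/∂x = A (x, f)`, with smooth
dependence on the initial value. -/
theorem exists_solution_of_contDiff (hA : ContDiff ℝ ∞ A)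
    (hsymm : ∀ᶠ z in nhds (0 : E × F), ∀ u v, fderiv ℝ A z (u, A z u) v =
      fderiv ℝ A z (v, A z v) u) :
    ∃ (U : Set (E × F)) (f : E × F → F), IsOpen U ∧ 0 ∈ U ∧ ContDiffOn ℝ ∞ f U ∧
      (∀ᶠ y in nhds (0 : F), f (0, y) = y) ∧
      ∀ z ∈ U, ∀ u, fderiv ℝ f z (u, 0) = A (z.1, f z) u := by
  have hdef := contDiff_defect hA
  have hinr : (fderiv ℝ (defect hA) (0, 0)).comp
      (ContinuousLinearMap.inr ℝ (E × F) (unitInterval →ᵇ F)) = ContinuousLinearMap.id ℝ _ := by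
    have h1 : HasFDerivAt (fun γ : (unitInterval →ᵇ F) ↦ defect hA (0, γ)) _ 0 :=
      ((hdef.differentiable (by simp) _).hasFDerivAt).comp (0 : (unitInterval →ᵇ F))
        (hasFDerivAt_prodMk_right (0 : E × F) (0 : (unitInterval →ᵇ F)))
    have h2 : (fun γ : (unitInterval →ᵇ F) ↦ defect hA (0, γ)) = fun γ ↦ γ := by
      funext γ
      exact (defect_zero_left hA 0 γ).trans (by simp)
    rw [h2] at h1
    exact h1.unique (hasFDerivAt_id _)
  obtain ⟨U, g, hU, h0U, hg, hg0, hgU, huniq⟩ := hdef.exists_implicitFunction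
    (a := (0 : E × F)) (b := 0) ((defect_zero_left hA 0 0).trans (by simp)) hinr
  have hgc : ContinuousAt g 0 := (hg.continuousOn.continuousAt (hU.mem_nhds h0U))
  -- Integrability is known only near `0`. Since `g` is continuous with `g 0 = 0` in sup norm, the
  -- whole path stays in that neighbourhood for small `z`.
  have hnear : ∀ᶠ z in nhds (0 : E × F), ∀ t : unitInterval, ∀ u v,
      fderiv ℝ A ((t : ℝ) • z.1, g z t) (u, A ((t : ℝ) • z.1, g z t) u) v =
      fderiv ℝ A ((t : ℝ) • z.1, g z t) (v, A ((t : ℝ) • z.1, g z t) v) u := by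
    obtain ⟨ε, hε, hball⟩ := Metric.eventually_nhds_iff_ball.1 hsymm
    have hp : ContinuousAt (fun z : E × F ↦ path E F (z.1, g z)) 0 :=
      (path E F).continuous.continuousAt.comp (continuousAt_fst.prodMk hgc)
    have hp0 : path E F ((0 : E × F).1, g 0) = 0 := by rw [hg0]; exact map_zero _
    have hpn : Filter.Tendsto (fun z : E × F ↦ ‖path E F (z.1, g z)‖) (nhds 0) (nhds 0) := by
      have := hp.norm.tendsto
      rwa [hp0, norm_zero] at this
    filter_upwards [hpn.eventually (gt_mem_nhds hε)] with z hz t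
    refine hball ((t : ℝ) • z.1, g z t) ?_
    have := ((path E F (z.1, g z)).norm_coe_le_norm t).trans_lt hz
    simpa using this
  obtain ⟨S, hSn, hS, h0S⟩ := eventually_nhds_iff.1 hnear
  let ev : (unitInterval →ᵇ F) →L[ℝ] F := BoundedContinuousFunction.evalCLM ℝ (1 : unitInterval)
  refine ⟨U ∩ S, fun z ↦ g z 1, hU.inter hS, ⟨h0U, h0S⟩, ?_, ?_, ?_⟩
  · exact ev.contDiff.comp_contDiffOn (hg.mono Set.inter_subset_left)
  · have hcont : Filter.Tendsto (fun y : F ↦ (((0 : E), y),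
        (BoundedContinuousFunction.constL unitInterval F y : (unitInterval →ᵇ F))))
        (nhds 0) (nhds ((0 : E × F), (0 : (unitInterval →ᵇ F)))) := by
      have : Continuous (fun y : F ↦ (((0 : E), y),
        (BoundedContinuousFunction.constL unitInterval F y : (unitInterval →ᵇ F)))) := by fun_prop
      have h := this.tendsto 0
      rwa [map_zero] at h
    -- The constant path at `y` solves the equation over `(0, y)`, so by local uniqueness it is `g
    -- (0, y)`.
    filter_upwards [hcont.eventually huniq] with y hy
    have := hy (by simp [defect_zero_left])
    exact (DFunLike.congr_fun this 1).symm
  · intro z hz u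
    have hgz : HasFDerivAt g (fderiv ℝ g z) z :=
      ((hg.contDiffAt (hU.mem_nhds hz.1)).differentiableAt (by simp)).hasFDerivAt
    have heq (w : E × F) (hw : w ∈ U) : g w = BoundedContinuousFunction.constL unitInterval _ w.2 +
        BoundedContinuousFunction.primitiveL F (velocity hA (w.1, g w)) := by
      have := hgU w hw
      rw [defect, sub_sub, sub_eq_zero] at this
      exact this
    have hder : HasFDerivAt (fun w : E × F ↦ BoundedContinuousFunction.constL unitInterval _ w.2 +
        BoundedContinuousFunction.primitiveL F (velocity hA (w.1, g w))) _ z :=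
      ((BoundedContinuousFunction.constL unitInterval F).hasFDerivAt.comp z
        hasFDerivAt_snd).add ((BoundedContinuousFunction.primitiveL F).hasFDerivAt.comp z
        ((((contDiff_velocity hA).differentiable (by simp) _).hasFDerivAt).comp z
          (hasFDerivAt_fst.prodMk hgz)))
    have hgz' := hgz.congr_of_eventuallyEq
      (Filter.eventuallyEq_of_mem (hU.mem_nhds hz.1) fun w hw ↦ (heq w hw).symm)
    -- Differentiating the integral equation in the direction `(u, 0)` gives the variational
    -- equation for the derivative of `g`.
    have hD := DFunLike.congr_fun (hgz'.unique hder) (u, 0)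
    have hev : fderiv ℝ (fun z ↦ g z 1) z (u, 0) = fderiv ℝ g z (u, 0) 1 := by
      have : HasFDerivAt (fun z ↦ g z 1) (ev.comp (fderiv ℝ g z)) z :=
        ev.hasFDerivAt.comp z hgz
      rw [this.fderiv]; rfl
    rw [hev]
    refine eq_of_variational hA (x := z.1) (y := z.2) (γ := g z) (fun t ↦ ?_) (fun t ↦ ?_)
      (hSn z hz.2)
    · exact DFunLike.congr_fun (heq z hz.1) t
    · have := DFunLike.congr_fun hD t
      simpa using this

/-- Local version of `exists_solution_of_contDiff`. -/
theorem exists_solution [FiniteDimensional ℝ E] [FiniteDimensional ℝ F] {Ω : Set (E × F)}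
    (hΩ : IsOpen Ω) (h0 : 0 ∈ Ω) (hA : ContDiffOn ℝ ∞ A Ω)
    (hsymm : ∀ z ∈ Ω, ∀ u v, fderiv ℝ A z (u, A z u) v = fderiv ℝ A z (v, A z v) u) :
    ∃ (U : Set (E × F)) (f : E × F → F), IsOpen U ∧ 0 ∈ U ∧ ContDiffOn ℝ ∞ f U ∧
      (∀ᶠ y in nhds (0 : F), f (0, y) = y) ∧
      ∀ z ∈ U, (z.1, f z) ∈ Ω ∧ ∀ u, fderiv ℝ f z (u, 0) = A (z.1, f z) u := by
  obtain ⟨B, hB, hBA⟩ := hA.exists_contDiff_eventuallyEq hΩ h0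
  obtain ⟨U, f, hU, h0U, hf, hf0, hfU⟩ := exists_solution_of_contDiff hB (by
    filter_upwards [hBA.eventuallyEq_nhds, hΩ.mem_nhds h0] with z hz hzΩ
    rw [hz.fderiv_eq, hz.self_of_nhds]
    exact hsymm z hzΩ)
  obtain ⟨S, hSn, hS, h0S⟩ := eventually_nhds_iff.1 (hBA.and (hΩ.mem_nhds h0))
  have hcont : ContinuousOn (fun z : E × F ↦ (z.1, f z)) U :=
    continuousOn_fst.prodMk hf.continuousOn
  -- The domain is shrunk so that the graph points `(x, f z)` stay where the global extension `B`
  -- agrees with `A`.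
  refine ⟨U ∩ (fun z ↦ (z.1, f z)) ⁻¹' S, f, hcont.isOpen_inter_preimage hU hS, ⟨h0U, ?_⟩,
    hf.mono Set.inter_subset_left, hf0, ?_⟩
  · have : f 0 = 0 := hf0.self_of_nhds
    simpa [this, ← Prod.zero_eq_mk] using h0S
  · intro z hz
    refine ⟨(hSn _ hz.2).2, fun u ↦ ?_⟩
    rw [hfU z hz.1, (hSn _ hz.2).1]

end TotalDifferential

/-! ### Straightening an involutive distribution in a vector space -/

section Straightening

universe u
variable {X E F : Type u} [NormedAddCommGroup X] [NormedSpace ℝ X] [FiniteDimensional ℝ X]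
  [NormedAddCommGroup E] [NormedSpace ℝ E] [FiniteDimensional ℝ E]
  [NormedAddCommGroup F] [NormedSpace ℝ F] [FiniteDimensional ℝ F]

/-- Leaves of an integrable total differential equation, as a local diffeomorphism. -/
theorem TotalDifferential.exists_openPartialHomeomorph {A : E × F → E →L[ℝ] F} {Ω : Set (E × F)}
    (hΩ : IsOpen Ω) (h0 : 0 ∈ Ω) (hA : ContDiffOn ℝ ∞ A Ω)
    (hsymm : ∀ z ∈ Ω, ∀ u v, fderiv ℝ A z (u, A z u) v = fderiv ℝ A z (v, A z v) u) :
    ∃ e : OpenPartialHomeomorph (E × F) (E × F), 0 ∈ e.source ∧ e 0 = 0 ∧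
      ContDiffOn ℝ ∞ e e.source ∧ ContDiffOn ℝ ∞ e.symm e.target ∧ e.target ⊆ Ω ∧
      ∀ z ∈ e.source, ∀ u, fderiv ℝ e z (u, 0) = (u, A (e z) u) := by
  obtain ⟨U, f, hU, h0U, hf, hf0, hfU⟩ := exists_solution hΩ h0 hA hsymm
  let Φ : E × F → E × F := fun z ↦ (z.1, f z)
  have hΦ : ContDiffOn ℝ ∞ Φ U := contDiffOn_fst.prodMk hf
  have hfd (z : E × F) (hz : z ∈ U) : HasFDerivAt f (fderiv ℝ f z) z :=
    ((hf.contDiffAt (hU.mem_nhds hz)).differentiableAt (by simp)).hasFDerivAt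
  have hΦd (z : E × F) (hz : z ∈ U) :
      HasFDerivAt Φ ((ContinuousLinearMap.fst ℝ E F).prod (fderiv ℝ f z)) z :=
    hasFDerivAt_fst.prodMk (hfd z hz)
  have hf00 : f 0 = 0 := hf0.self_of_nhds
  -- From `f (0, y) = y`: the derivative of `Φ` at `0` is block triangular with identity diagonal
  -- blocks, hence invertible.
  have hinr (w : F) : fderiv ℝ f 0 (0, w) = w := by
    have h1 : HasFDerivAt (fun y : F ↦ f (0, y)) _ 0 :=
      (hfd 0 h0U).comp (0 : F) (hasFDerivAt_prodMk_right (0 : E) (0 : F))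
    have h2 : HasFDerivAt (fun y : F ↦ f (0, y)) (ContinuousLinearMap.id ℝ F) 0 :=
      (hasFDerivAt_id _).congr_of_eventuallyEq hf0
    exact DFunLike.congr_fun (h1.unique h2) w
  have hL' (v : E) (w : F) : fderiv ℝ f 0 (v, w) = fderiv ℝ f 0 (v, 0) + w := by
    nth_rw 2 [← hinr w]
    rw [← map_add]; simp
  let Φ' : (E × F) ≃L[ℝ] E × F := ContinuousLinearEquiv.equivOfInverse
    ((ContinuousLinearMap.fst ℝ E F).prod (fderiv ℝ f 0))
    ((ContinuousLinearMap.fst ℝ E F).prod (ContinuousLinearMap.snd ℝ E F -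
      (fderiv ℝ f 0).comp
        ((ContinuousLinearMap.inl ℝ E F).comp (ContinuousLinearMap.fst ℝ E F))))
    (by rintro ⟨v, w⟩; simp [hL' v w]) (by rintro ⟨v, w⟩; simp [hL' v (w - _)])
  obtain ⟨e, he, h0e, heU, hsymm⟩ := hΦ.exists_openPartialHomeomorph hU h0U Φ' (hΦd 0 h0U)
  refine ⟨e, h0e, by simp [he, Φ, hf00], ?_, hsymm, ?_, ?_⟩
  · rw [he]; exact hΦ.mono heU
  · intro z hz
    have h1 := (hfU _ (heU (e.map_target hz))).1
    have h2 : Φ (e.symm z) = z := (congrFun he _).symm.trans (e.right_inv hz)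
    rw [← h2]; exact h1
  · intro z hz u
    rw [he, (hΦd z (heU hz)).fderiv]
    simp [Φ, (hfU z (heU hz)).2 u]

/-- Frobenius' theorem in a vector space: an involutive distribution that is spanned by a smooth
frame is locally the tangent distribution of the first factor, in suitable coordinates. -/
theorem exists_straightening {k : ℕ} {D : X → Submodule ℝ X} {O : Set X} (hO : IsOpen O) {p : X}
    (hp : p ∈ O) {Y : Fin k → X → X} (hY : ∀ i, ContDiffOn ℝ ∞ (Y i) O)
    (hDY : ∀ x ∈ O, D x = Submodule.span ℝ (Set.range fun i ↦ Y i x))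
    (hDk : Module.finrank ℝ (D p) = k)
    (hinv : ∀ O' ⊆ O, IsOpen O' → ∀ V W : X → X, ContDiffOn ℝ ∞ V O' → ContDiffOn ℝ ∞ W O' →
      (∀ x ∈ O', V x ∈ D x) → (∀ x ∈ O', W x ∈ D x) →
      ∀ x ∈ O', VectorField.lieBracket ℝ V W x ∈ D x)
    (hE : Module.finrank ℝ E = k)
    (hEF : Module.finrank ℝ E + Module.finrank ℝ F = Module.finrank ℝ X) :
    ∃ (e : OpenPartialHomeomorph X (E × F)) (U' : Set E) (U'' : Set F), p ∈ e.source ∧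
      e.source ⊆ O ∧ e.target = U' ×ˢ U'' ∧ ContDiffOn ℝ ∞ e e.source ∧
      ContDiffOn ℝ ∞ e.symm e.target ∧
      ∀ z ∈ e.target, (D (e.symm z) : Set X) = Set.range fun u : E ↦ fderiv ℝ e.symm z (u, 0) := by
  obtain ⟨Q, hQ⟩ := (D p).exists_isCompl
  have hQF : Module.finrank ℝ Q = Module.finrank ℝ F := by
    have := Submodule.finrank_add_eq_of_isCompl hQ
    omega
  let l₁ : D p ≃ₗ[ℝ] E := LinearEquiv.ofFinrankEq _ _ (hDk.trans hE.symm)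
  let l₂ : Q ≃ₗ[ℝ] F := LinearEquiv.ofFinrankEq _ _ hQF
  let L : X ≃L[ℝ] E × F := ((Submodule.prodEquivOfIsCompl (D p) Q hQ).symm.trans
    (l₁.prodCongr l₂)).toContinuousLinearEquiv
  let P : X →L[ℝ] E := (ContinuousLinearMap.fst ℝ E F).comp (L : X →L[ℝ] E × F)
  have hPD (x : X) (hx : x ∈ D p) (hPx : P x = 0) : x = 0 := by
    have h1 : (Submodule.prodEquivOfIsCompl (D p) Q hQ).symm x = ((⟨x, hx⟩ : D p), (0 : Q)) :=
      Submodule.prodEquivOfIsCompl_symm_apply_left _ _ hQ ⟨x, hx⟩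
    have h2 : P x = l₁ ⟨x, hx⟩ := by
      simp [P, L, h1]
    rw [h2, LinearEquiv.map_eq_zero_iff] at hPx
    exact congrArg Subtype.val hPx
  let S : X → (Fin k → ℝ) →L[ℝ] X := fun x ↦
    ∑ i, (ContinuousLinearMap.proj (R := ℝ) (φ := fun _ : Fin k ↦ ℝ) i).smulRight (Y i x)
  have hS_apply (x : X) (c : Fin k → ℝ) : S x c = ∑ i, c i • Y i x := by
    simp [S]
  have hSsmooth : ContDiffOn ℝ ∞ S O := ContDiffOn.sum fun i _ ↦
    contDiffOn_const.smulRight (hY i)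
  have hS_range (x : X) (hx : x ∈ O) (w : X) : w ∈ D x ↔ ∃ c, S x c = w := by
    simp only [hDY x hx, Submodule.mem_span_range_iff_exists_fun, hS_apply]
  let T : X → (Fin k → ℝ) →L[ℝ] E := fun x ↦ P.comp (S x)
  have hTsmooth : ContDiffOn ℝ ∞ T O := contDiffOn_const.clm_comp hSsmooth
  have hSinj : Function.Injective (S p) := by
    have hli : LinearIndependent ℝ fun i ↦ Y i p := by
      rw [linearIndependent_iff_card_eq_finrank_span, Fintype.card_fin, Set.finrank, ← hDY p hp,
        hDk]
    rw [injective_iff_map_eq_zero]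
    intro c hc
    rw [hS_apply] at hc
    exact funext (Fintype.linearIndependent_iff.1 hli c hc)
  have hTp : ∃ T' : (Fin k → ℝ) ≃L[ℝ] E, (T' : (Fin k → ℝ) →L[ℝ] E) = T p := by
    have hinj : Function.Injective (T p : (Fin k → ℝ) →ₗ[ℝ] E) := by
      rw [injective_iff_map_eq_zero]
      intro c hc
      exact hSinj (((hPD _ ((hS_range p hp _).2 ⟨c, rfl⟩) hc)).trans (map_zero _).symm)
    refine ⟨(LinearEquiv.ofInjectiveOfFinrankEq (T p : (Fin k → ℝ) →ₗ[ℝ] E) hinj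
      (by simp [hE])).toContinuousLinearEquiv, ?_⟩
    ext c
    exact DFunLike.congr_fun (LinearEquiv.coe_ofInjectiveOfFinrankEq _ hinj (by simp [hE])) c
  -- The points where `P` still maps `D x` isomorphically onto `E`.
  let O' : Set X := O ∩ T ⁻¹' Set.range ((↑) : ((Fin k → ℝ) ≃L[ℝ] E) → (Fin k → ℝ) →L[ℝ] E)
  have hO' : IsOpen O' :=
    hTsmooth.continuousOn.isOpen_inter_preimage hO ContinuousLinearEquiv.isOpen
  have hpO' : p ∈ O' := ⟨hp, hTp⟩
  -- `R x u` is the unique vector of `D x` with `P`-component `u`, for `x` in `O'`.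
  let R : X → E →L[ℝ] X := fun x ↦ (S x).comp (T x).inverse
  have hR : ContDiffOn ℝ ∞ R O' := by
    refine (hSsmooth.mono Set.inter_subset_left).clm_comp fun x hx ↦ ?_
    obtain ⟨T', hT'⟩ := hx.2
    have h1 : ContDiffAt ℝ ∞ ContinuousLinearMap.inverse (T x) := by
      rw [← hT']; exact contDiffAt_map_inverse T'
    exact h1.comp_contDiffWithinAt x (hTsmooth.mono Set.inter_subset_left x hx)
  have hPR (x : X) (hx : x ∈ O') (u : E) : P (R x u) = u := by
    obtain ⟨T', hT'⟩ := hx.2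
    change T x ((T x).inverse u) = u
    rw [← hT', ContinuousLinearMap.inverse_equiv]
    simp
  have hRD (x : X) (hx : x ∈ O') (u : E) : R x u ∈ D x := (hS_range x hx.1 _).2 ⟨_, rfl⟩
  have hDR (x : X) (hx : x ∈ O') (w : X) (hw : w ∈ D x) : w = R x (P w) := by
    obtain ⟨c, rfl⟩ := (hS_range x hx.1 _).1 hw
    obtain ⟨T', hT'⟩ := hx.2
    change _ = S x ((T x).inverse (T x c))
    rw [← hT', ContinuousLinearMap.inverse_equiv]
    simp
  have hRd (x : X) (hx : x ∈ O') : HasFDerivAt R (fderiv ℝ R x) x :=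
    ((hR.contDiffAt (hO'.mem_nhds hx)).differentiableAt (by simp)).hasFDerivAt
  have hRud (x : X) (hx : x ∈ O') (u : E) (w : X) :
      fderiv ℝ (fun x ↦ R x u) x w = fderiv ℝ R x w u := by
    rw [((hRd x hx).clm_apply (hasFDerivAt_const u x)).fderiv]; simp
  have hPdR (x : X) (hx : x ∈ O') (u : E) (w : X) : P (fderiv ℝ R x w u) = 0 := by
    rw [← hRud x hx]
    have h1 : HasFDerivAt (fun x ↦ P (R x u)) _ x := P.hasFDerivAt.comp x
      ((hRd x hx).clm_apply (hasFDerivAt_const u x))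
    have h2 : HasFDerivAt (fun x ↦ P (R x u)) (0 : X →L[ℝ] E) x :=
      (hasFDerivAt_const u x).congr_of_eventuallyEq
        (Filter.eventuallyEq_of_mem (hO'.mem_nhds hx) fun y hy ↦ hPR y hy u)
    rw [((hRd x hx).clm_apply (hasFDerivAt_const u x)).fderiv]
    exact DFunLike.congr_fun (h1.unique h2) w
  -- The bracket of the lifts of `u` and `v` lies in `D x`, and `P` kills it because `P (R x u) = u`
  -- is constant in `x`. As `P` is injective on `D x`, the lifts commute.
  have hcomm (x : X) (hx : x ∈ O') (u v : E) :
      fderiv ℝ R x (R x u) v = fderiv ℝ R x (R x v) u := by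
    have h1 := hinv O' Set.inter_subset_left hO' (fun x ↦ R x u) (fun x ↦ R x v)
      (hR.clm_apply contDiffOn_const) (hR.clm_apply contDiffOn_const)
      (fun x hx ↦ hRD x hx u) (fun x hx ↦ hRD x hx v) x hx
    rw [VectorField.lieBracket, hRud x hx, hRud x hx] at h1
    have h2 := hDR x hx _ h1
    rwa [map_sub P, hPdR x hx, hPdR x hx, sub_zero, map_zero, sub_eq_zero] at h2
  let α : E × F → X := fun z ↦ p + L.symm z
  have hα : ContDiff ℝ ∞ α := contDiff_const.add L.symm.contDiff
  let q : X →L[ℝ] F := (ContinuousLinearMap.snd ℝ E F).comp (L : X →L[ℝ] E × F)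
  -- In the coordinates `L` centred at `p`, the distribution is the graph of `A`, and `hcomm`
  -- becomes the integrability condition for `A`.
  let A : E × F → E →L[ℝ] F := fun z ↦ q.comp (R (α z))
  have hLR (z : E × F) (hz : α z ∈ O') (u : E) : L.symm (u, A z u) = R (α z) u := by
    rw [ContinuousLinearEquiv.symm_apply_eq]
    exact Prod.ext (hPR _ hz u).symm rfl
  have hAd (z : E × F) (hz : α z ∈ O') (w : E × F) (v : E) :
      fderiv ℝ A z w v = q (fderiv ℝ R (α z) (L.symm w) v) := by
    have h1 : HasFDerivAt α (L.symm : E × F →L[ℝ] X) z := L.symm.hasFDerivAt.const_add p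
    have h2 : HasFDerivAt A _ z :=
      (hasFDerivAt_const q z).clm_comp ((hRd _ hz).comp z h1)
    rw [h2.fderiv]
    simp
  obtain ⟨e, h0e, he0, he, hesymm, heΩ, hde⟩ :=
    TotalDifferential.exists_openPartialHomeomorph (A := A) (hO'.preimage hα.continuous)
      (by simpa [α] using hpO')
      (contDiffOn_const.clm_comp (hR.comp hα.contDiffOn fun z hz ↦ hz))
      (fun z hz u v ↦ by rw [hAd z hz, hAd z hz, hLR z hz, hLR z hz, hcomm _ hz])
  let τ : X ≃ₜ E × F := (Homeomorph.subRight p).trans L.toHomeomorph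
  have hτ : ContDiff ℝ ∞ τ := L.contDiff.comp (contDiff_id.sub contDiff_const)
  have hτs (z : E × F) : τ.symm z = α z := by
    rw [Homeomorph.symm_apply_eq]; simp [τ, α]
  let e₁ : OpenPartialHomeomorph (E × F) X := e.trans τ.symm.toOpenPartialHomeomorph
  have he₁ (z : E × F) : e₁ z = α (e z) := hτs (e z)
  have he₁s : e₁.source = e.source := by simp [e₁]
  -- Restricting to a box gives the product shape required of a flat chart.
  obtain ⟨U', U'', hU', h0U', hU'', h0U'', hbox⟩ :=
    mem_nhds_prod_iff'.1 (e.open_source.mem_nhds h0e)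
  let e₂ := e₁.restrOpen (U' ×ˢ U'') (hU'.prod hU'')
  have he₂ (z : E × F) : e₂ z = α (e z) := he₁ z
  have he₂s : e₂.source = U' ×ˢ U'' := by
    rw [OpenPartialHomeomorph.restrOpen_source, he₁s]
    exact Set.inter_eq_right.2 hbox
  have he₂α : (e₂ : E × F → X) = α ∘ e := funext he₂
  have hsub (z : E × F) (hz : z ∈ e₂.source) : z ∈ e.source := hbox (he₂s ▸ hz)
  have hmem (z : E × F) (hz : z ∈ e₂.source) : α (e z) ∈ O' := heΩ (e.map_source (hsub z hz))
  refine ⟨e₂.symm, U', U'', ?_, ?_, he₂s, ?_, ?_, ?_⟩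
  · have h1 : e₂ 0 = p := by simp [he₂, he0, α]
    rw [← h1]
    exact e₂.map_source (by rw [he₂s]; exact ⟨h0U', h0U''⟩)
  · intro x hx
    have h1 := hmem _ (e₂.map_target hx)
    rw [← he₂, e₂.right_inv hx] at h1
    exact h1.1
  · refine hesymm.comp hτ.contDiffOn fun x hx ↦ ?_
    have h1 := e.map_source (hsub _ (e₂.map_target hx))
    have h2 : τ x = e (e₂.symm x) := by
      rw [← τ.eq_symm_apply, hτs, ← he₂]
      exact (e₂.right_inv hx).symm
    exact (congrArg (· ∈ e.target) h2).mpr h1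
  · change ContDiffOn ℝ ∞ e₂ e₂.source
    rw [he₂α]
    exact hα.comp_contDiffOn (he.mono hsub)
  · intro z hz
    change (D (e₂ z) : Set X) = Set.range fun u : E ↦ fderiv ℝ e₂ z (u, 0)
    have hez : HasFDerivAt e (fderiv ℝ e z) z := ((he.contDiffAt
      (e.open_source.mem_nhds (hsub z hz))).differentiableAt (by simp)).hasFDerivAt
    have hd : HasFDerivAt e₂ ((L.symm : E × F →L[ℝ] X).comp (fderiv ℝ e z)) z := by
      rw [he₂α]
      exact (L.symm.hasFDerivAt.const_add p).comp z hez
    have hdu (u : E) : fderiv ℝ e₂ z (u, 0) = R (e₂ z) u := by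
      rw [hd.fderiv, ContinuousLinearMap.comp_apply, hde z (hsub z hz), he₂]
      exact hLR _ (hmem z hz) u
    simp only [hdu]
    have hm : e₂ z ∈ O' := he₂ z ▸ hmem z hz
    ext w
    constructor
    · intro hw
      exact ⟨P w, (hDR _ hm w hw).symm⟩
    · rintro ⟨u, rfl⟩
      exact hRD _ hm u

end Straightening

/-! ### Derivatives of charts and vector fields read in a chart -/

section Charts

variable {n : ℕ} {M : Type*} [TopologicalSpace M] [ChartedSpace (EuclideanSpace ℝ (Fin n)) M]
  {φ : OpenPartialHomeomorph M (EuclideanSpace ℝ (Fin n))}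

lemma IsManifold.mdifferentiable_of_mem_maximalAtlas
    (hφ : φ ∈ IsManifold.maximalAtlas (𝓡 n) ∞ M) : φ.MDifferentiable (𝓡 n) (𝓡 n) :=
  ⟨(contMDiffOn_of_mem_maximalAtlas hφ).mdifferentiableOn (by simp),
    (contMDiffOn_symm_of_mem_maximalAtlas hφ).mdifferentiableOn (by simp)⟩

/-- `mpullback` applies the `inverse` of a derivative; this turns it into the derivative of the
inverse chart. -/
lemma OpenPartialHomeomorph.MDifferentiable.inverse_mfderiv (hφ : φ.MDifferentiable (𝓡 n) (𝓡 n))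
    {q : M} (hq : q ∈ φ.source) :
    (mfderiv (𝓡 n) (𝓡 n) φ q).inverse = mfderiv (𝓡 n) (𝓡 n) φ.symm (φ q) := by
  refine ContinuousLinearMap.inverse_eq ?_ (hφ.symm_comp_deriv hq)
  have := hφ.comp_symm_deriv (φ.map_source hq)
  rwa [φ.left_inv hq] at this

lemma OpenPartialHomeomorph.MDifferentiable.isInvertible_mfderiv
    (hφ : φ.MDifferentiable (𝓡 n) (𝓡 n)) {q : M} (hq : q ∈ φ.source) :
    (mfderiv (𝓡 n) (𝓡 n) φ q).IsInvertible := ⟨hφ.mfderiv hq, rfl⟩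

lemma OpenPartialHomeomorph.MDifferentiable.isInvertible_mfderiv_symm
    (hφ : φ.MDifferentiable (𝓡 n) (𝓡 n)) {x : EuclideanSpace ℝ (Fin n)} (hx : x ∈ φ.target) :
    (mfderiv (𝓡 n) (𝓡 n) φ.symm x).IsInvertible := ⟨hφ.symm.mfderiv hx, rfl⟩

lemma OpenPartialHomeomorph.MDifferentiable.inverse_mfderiv_symm
    (hφ : φ.MDifferentiable (𝓡 n) (𝓡 n)) {x : EuclideanSpace ℝ (Fin n)} (hx : x ∈ φ.target) :
    (mfderiv (𝓡 n) (𝓡 n) φ.symm x).inverse = mfderiv (𝓡 n) (𝓡 n) φ (φ.symm x) := by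
  refine ContinuousLinearMap.inverse_eq ?_ (hφ.comp_symm_deriv hx)
  have := hφ.symm_comp_deriv (φ.map_target hx)
  rwa [φ.right_inv hx] at this

lemma VectorField.mlieBracket_eq_lieBracket
    {V W : EuclideanSpace ℝ (Fin n) → EuclideanSpace ℝ (Fin n)}
    (x : EuclideanSpace ℝ (Fin n)) :
    (VectorField.mlieBracket (𝓡 n) (fun x ↦ (V x : TangentSpace (𝓡 n) x))
      (fun x ↦ (W x : TangentSpace (𝓡 n) x)) x : EuclideanSpace ℝ (Fin n)) =
      VectorField.lieBracket ℝ V W x :=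
  (congrFun (VectorField.mlieBracketWithin_eq_lieBracketWithin (V := V) (W := W)
    (s := Set.univ)) x).trans (congrFun VectorField.lieBracketWithin_univ x)

/-- A vector field read in a chart. -/
noncomputable def VectorField.inChart (φ : OpenPartialHomeomorph M (EuclideanSpace ℝ (Fin n)))
    (X : (p : M) → TangentSpace (𝓡 n) p) (x : EuclideanSpace ℝ (Fin n)) :
    EuclideanSpace ℝ (Fin n) :=
  VectorField.mpullback (𝓡 n) (𝓡 n) φ.symm X x

end Charts

/-! ### Distributions and brackets read in a chart -/

namespace TangentDistribution

variable {n k : ℕ} {M : Type*} [TopologicalSpace M] [ChartedSpace (EuclideanSpace ℝ (Fin n)) M]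
  (D : TangentDistribution n k M) {φ : OpenPartialHomeomorph M (EuclideanSpace ℝ (Fin n))}

/-- The distribution read in a chart. -/
noncomputable def inChart (φ : OpenPartialHomeomorph M (EuclideanSpace ℝ (Fin n)))
    (x : EuclideanSpace ℝ (Fin n)) : Submodule ℝ (EuclideanSpace ℝ (Fin n)) :=
  (D.toFun (φ.symm x)).comap (mfderiv (𝓡 n) (𝓡 n) φ.symm x).toLinearMap

variable {D}

lemma mem_inChart {x w : EuclideanSpace ℝ (Fin n)} :
    w ∈ D.inChart φ x ↔ mfderiv (𝓡 n) (𝓡 n) φ.symm x w ∈ D.toFun (φ.symm x) := Iff.rfl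

/-- All tangent spaces are the model space by definition, so a vector needs no cast when its base
point is rewritten, for instance along `φ.symm (φ q) = q`. -/
lemma mem_toFun_congr {p q : M} (h : p = q) (v : EuclideanSpace ℝ (Fin n)) :
    v ∈ D.toFun p ↔ v ∈ D.toFun q := by subst h; rfl

lemma mfderiv_mem_inChart (hφ : φ ∈ IsManifold.maximalAtlas (𝓡 n) ∞ M) {q : M}
    (hq : q ∈ φ.source) (v : EuclideanSpace ℝ (Fin n)) :
    (mfderiv (𝓡 n) (𝓡 n) φ q v : EuclideanSpace ℝ (Fin n)) ∈ D.inChart φ (φ q) ↔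
      v ∈ D.toFun q := by
  have h : (mfderiv (𝓡 n) (𝓡 n) φ.symm (φ q) (mfderiv (𝓡 n) (𝓡 n) φ q v) :
      EuclideanSpace ℝ (Fin n)) = v := DFunLike.congr_fun
    ((IsManifold.mdifferentiable_of_mem_maximalAtlas hφ).symm_comp_deriv hq) v
  refine mem_inChart.trans (Iff.trans ?_ (mem_toFun_congr (φ.left_inv hq) v))
  exact iff_of_eq (congrArg (fun w : EuclideanSpace ℝ (Fin n) ↦ w ∈ D.toFun (φ.symm (φ q))) h)

lemma finrank_inChart (hφ : φ ∈ IsManifold.maximalAtlas (𝓡 n) ∞ M)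
    {x : EuclideanSpace ℝ (Fin n)} (hx : x ∈ φ.target) :
    Module.finrank ℝ (D.inChart φ x) = k := by
  let e := ((IsManifold.mdifferentiable_of_mem_maximalAtlas hφ).symm.mfderiv hx).toLinearEquiv
  exact (e.ofSubmodule' (D.toFun (φ.symm x))).finrank_eq.trans (D.finrank_eq (φ.symm x))

/-- Pulling back along a chart a vector field that lies in the distribution read in the chart. -/
lemma mpullback_mem (hφ : φ ∈ IsManifold.maximalAtlas (𝓡 n) ∞ M)
    {V : (x : EuclideanSpace ℝ (Fin n)) → TangentSpace (𝓡 n) x} {q : M} (hq : q ∈ φ.source)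
    (hV : V (φ q) ∈ D.inChart φ (φ q)) :
    VectorField.mpullback (𝓡 n) (𝓡 n) φ V q ∈ D.toFun q := by
  have h := (IsManifold.mdifferentiable_of_mem_maximalAtlas hφ).inverse_mfderiv hq
  rw [VectorField.mpullback_apply, h]
  exact (mem_toFun_congr (φ.left_inv hq) _).1 (mem_inChart.1 hV)

variable [IsManifold (𝓡 n) ∞ M]

lemma contMDiffAt_mpullback_chart (hφ : φ ∈ IsManifold.maximalAtlas (𝓡 n) ∞ M)
    {V : EuclideanSpace ℝ (Fin n) → EuclideanSpace ℝ (Fin n)} {q : M} (hq : q ∈ φ.source)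
    (hV : ContDiffAt ℝ ∞ V (φ q)) :
    ContMDiffAt (𝓡 n) (𝓡 n).tangent ∞
      (fun m ↦ (⟨m, VectorField.mpullback (𝓡 n) (𝓡 n) φ (fun x ↦ (V x : TangentSpace (𝓡 n) x)) m⟩ :
        TangentBundle (𝓡 n) M)) q :=
  ContMDiffAt.mpullback_vectorField_preimage (n := ∞)
    (V := fun x ↦ (V x : TangentSpace (𝓡 n) x))
    (contMDiffAt_vectorSpace_iff_contDiffAt.2 hV) (contMDiffAt_of_mem_maximalAtlas hφ hq)
    ((IsManifold.mdifferentiable_of_mem_maximalAtlas hφ).isInvertible_mfderiv hq) (by simp)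

/-- A local vector field in a chart extends to a global vector field on the manifold, lying in the
distribution. -/
lemma exists_smoothVectorField [T2Space M] (hφ : φ ∈ IsManifold.maximalAtlas (𝓡 n) ∞ M)
    {O : Set (EuclideanSpace ℝ (Fin n))} (hOφ : O ⊆ φ.target) (hO : IsOpen O)
    {V : EuclideanSpace ℝ (Fin n) → EuclideanSpace ℝ (Fin n)} (hV : ContDiffOn ℝ ∞ V O)
    (hVD : ∀ x ∈ O, V x ∈ D.inChart φ x) {x : EuclideanSpace ℝ (Fin n)} (hx : x ∈ O) :
    ∃ X : (p : M) → TangentSpace (𝓡 n) p, SmoothVectorFieldOn X Set.univ ∧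
      (∀ p, X p ∈ D.toFun p) ∧
      VectorField.inChart φ X =ᶠ[nhds x] V := by
  have hd := IsManifold.mdifferentiable_of_mem_maximalAtlas hφ
  let G : Set M := φ.source ∩ φ ⁻¹' O
  have hG : IsOpen G := φ.isOpen_inter_preimage hO
  have hxφ : x ∈ φ.target := hOφ hx
  have hxG : φ.symm x ∈ G := ⟨φ.map_target hxφ, by simpa [φ.right_inv hxφ] using hx⟩
  obtain ⟨ψ, hψ, hψ1, hψG⟩ : ∃ ψ : M → ℝ, ContMDiff (𝓡 n) 𝓘(ℝ, ℝ) ∞ ψ ∧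
      ψ =ᶠ[nhds (φ.symm x)] 1 ∧ tsupport ψ ⊆ G := by
    obtain ⟨f, -, hf⟩ := (SmoothBumpFunction.nhds_basis_tsupport (I := 𝓡 n)
      (φ.symm x)).mem_iff.1 (hG.mem_nhds hxG)
    exact ⟨f, f.contMDiff, f.eventuallyEq_one, hf⟩
  let V' : (x : EuclideanSpace ℝ (Fin n)) → TangentSpace (𝓡 n) x := V
  let P : (p : M) → TangentSpace (𝓡 n) p := VectorField.mpullback (𝓡 n) (𝓡 n) φ V'
  -- Involutivity speaks of global fields only. The cutoff `ψ` vanishes outside `G`, where `P` need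
  -- not lie in `D`, and is `1` near the point of interest.
  refine ⟨ψ • P, ?_, ?_, ?_⟩
  · refine ContMDiff.contMDiffOn ?_
    refine ContMDiffOn.smul_section_of_tsupport hψ.contMDiffOn hG hψG fun m hm ↦ ?_
    exact (contMDiffAt_mpullback_chart hφ hm.1
      (hV.contDiffAt (hO.mem_nhds hm.2))).contMDiffWithinAt
  · intro m
    by_cases hm : m ∈ G
    · exact (D.toFun m).smul_mem _ (mpullback_mem hφ hm.1 (hVD _ hm.2))
    · have h0 : ψ m = 0 := image_eq_zero_of_notMem_tsupport fun h ↦ hm (hψG h)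
      simp [h0]
  · have hc : ∀ᶠ y in nhds x, ψ (φ.symm y) = 1 := (φ.continuousAt_symm hxφ).eventually hψ1
    filter_upwards [hc, φ.open_target.mem_nhds hxφ] with y hy hyφ
    rw [VectorField.inChart, VectorField.mpullback_apply, hd.inverse_mfderiv_symm hyφ]
    have h1 : (ψ • P) (φ.symm y) = P (φ.symm y) := by simp [hy]
    rw [h1]
    change mfderiv (𝓡 n) (𝓡 n) φ (φ.symm y)
      ((mfderiv (𝓡 n) (𝓡 n) φ (φ.symm y)).inverse (V' (φ (φ.symm y)))) = V y
    rw [hd.inverse_mfderiv (φ.map_target hyφ), φ.right_inv hyφ]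
    exact DFunLike.congr_fun (hd.comp_symm_deriv hyφ) (V y)

/-- The Lie bracket of smooth vector fields, computed in a chart. -/
lemma mfderiv_symm_lieBracket (hφ : φ ∈ IsManifold.maximalAtlas (𝓡 n) ∞ M)
    {X Y : (p : M) → TangentSpace (𝓡 n) p} (hX : SmoothVectorFieldOn X Set.univ)
    (hY : SmoothVectorFieldOn Y Set.univ) {x : EuclideanSpace ℝ (Fin n)} (hx : x ∈ φ.target) :
    mfderiv (𝓡 n) (𝓡 n) φ.symm x
      (VectorField.lieBracket ℝ (E := EuclideanSpace ℝ (Fin n)) (VectorField.inChart φ X)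
        (VectorField.inChart φ Y) x) =
      VectorField.mlieBracket (𝓡 n) X Y (φ.symm x) := by
  have hd := IsManifold.mdifferentiable_of_mem_maximalAtlas hφ
  have h2 : minSmoothness ℝ 2 ≤ (∞ : ℕ∞ω) := by
    rw [minSmoothness_of_isRCLikeNormedField]; exact WithTop.coe_le_coe.2 le_top
  have : IsManifold (𝓡 n) (minSmoothness ℝ 2) M := IsManifold.of_le (n := ∞) h2
  have hdiff {X : (p : M) → TangentSpace (𝓡 n) p} (hX : SmoothVectorFieldOn X Set.univ) (p : M) :
      MDifferentiableAt (𝓡 n) (𝓡 n).tangent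
        (fun p ↦ (⟨p, X p⟩ : TangentBundle (𝓡 n) M)) p :=
    (contMDiffOn_univ.1 hX).mdifferentiable (by simp) p
  have hpull := VectorField.mpullback_mlieBracket (hdiff hX (φ.symm x)) (hdiff hY (φ.symm x))
    (contMDiffAt_symm_of_mem_maximalAtlas hφ hx) h2
  have heq : VectorField.lieBracket ℝ (VectorField.inChart φ X) (VectorField.inChart φ Y) x =
      mfderiv (𝓡 n) (𝓡 n) φ (φ.symm x) (VectorField.mlieBracket (𝓡 n) X Y (φ.symm x)) := by
    rw [← hd.inverse_mfderiv_symm hx]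
    exact (VectorField.mlieBracket_eq_lieBracket x).symm.trans hpull.symm
  rw [heq]
  have h := hd.symm_comp_deriv (φ.map_target hx)
  rw [φ.right_inv hx] at h
  exact DFunLike.congr_fun h _

/-- Lie brackets, in a chart, of local vector fields that lie in an involutive distribution. -/
lemma IsInvolutive.lieBracket_mem_inChart [T2Space M]
    (hD : D.IsInvolutive) (hφ : φ ∈ IsManifold.maximalAtlas (𝓡 n) ∞ M)
    {O : Set (EuclideanSpace ℝ (Fin n))} (hOφ : O ⊆ φ.target) (hO : IsOpen O)
    {V W : EuclideanSpace ℝ (Fin n) → EuclideanSpace ℝ (Fin n)} (hV : ContDiffOn ℝ ∞ V O)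
    (hW : ContDiffOn ℝ ∞ W O) (hVD : ∀ x ∈ O, V x ∈ D.inChart φ x)
    (hWD : ∀ x ∈ O, W x ∈ D.inChart φ x) {x : EuclideanSpace ℝ (Fin n)} (hx : x ∈ O) :
    VectorField.lieBracket ℝ V W x ∈ D.inChart φ x := by
  have hxφ : x ∈ φ.target := hOφ hx
  obtain ⟨X, hX, hXD, hXV⟩ := exists_smoothVectorField hφ hOφ hO hV hVD hx
  obtain ⟨Y, hY, hYD, hYW⟩ := exists_smoothVectorField hφ hOφ hO hW hWD hx
  have hXY := hD X Y hX hY hXD hYD (φ.symm x)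
  rw [← mfderiv_symm_lieBracket hφ hX hY hxφ] at hXY
  -- The bracket at `x` depends only on the germs at `x`, which the global extensions share with `V`
  -- and `W`.
  have hVW : VectorField.lieBracket ℝ (VectorField.inChart φ X)
      (VectorField.inChart φ Y) x = VectorField.lieBracket ℝ V W x :=
    Filter.EventuallyEq.lieBracket_vectorField_eq hXV hYW
  rw [hVW] at hXY
  exact hXY

end TangentDistribution

/-! ### Splitting off the first `k` coordinates -/

section SplitCoordinates

/-- Euclidean space as the product of the first `k` and the remaining coordinates. -/
noncomputable def EuclideanSpace.splitCoordinates (n k : ℕ) :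
    (({j : Fin n // j.val < k} → ℝ) × ({j : Fin n // k ≤ j.val} → ℝ)) ≃L[ℝ]
      EuclideanSpace ℝ (Fin n) :=
  LinearEquiv.toContinuousLinearEquiv
    { toFun := fun z ↦ WithLp.toLp 2 fun j ↦
        if h : j.val < k then z.1 ⟨j, h⟩ else z.2 ⟨j, not_lt.1 h⟩
      map_add' := fun z w ↦ by
        ext j
        by_cases h : j.val < k <;> simp [h]
      map_smul' := fun c z ↦ by
        ext j
        by_cases h : j.val < k <;> simp [h]
      invFun := fun x ↦ (fun j ↦ x j.val, fun j ↦ x j.val)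
      left_inv := fun z ↦ by
        ext j
        · simp [j.2]
        · simp [not_lt.2 j.2]
      right_inv := fun x ↦ by
        ext j
        by_cases h : j.val < k <;> simp [h] }

variable {n k : ℕ}

lemma EuclideanSpace.splitCoordinates_symm_apply (x : EuclideanSpace ℝ (Fin n)) :
    (EuclideanSpace.splitCoordinates n k).symm x = (fun j ↦ x j.val, fun j ↦ x j.val) := rfl

lemma EuclideanSpace.splitCoordinates_apply_of_le
    (z : ({j : Fin n // j.val < k} → ℝ) × ({j : Fin n // k ≤ j.val} → ℝ))
    (j : {j : Fin n // k ≤ j.val}) : EuclideanSpace.splitCoordinates n k z j.val = z.2 j :=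
  dif_neg (not_lt.2 j.2)

lemma finrank_fin_lt (h : k ≤ n) : Module.finrank ℝ ({j : Fin n // j.val < k} → ℝ) = k := by
  rw [Module.finrank_fintype_fun_eq_card]
  refine (Fintype.card_congr (?_ : {j : Fin n // j.val < k} ≃ Fin k)).trans (Fintype.card_fin k)
  exact
    { toFun := fun j ↦ ⟨j.1, j.2⟩
      invFun := fun j ↦ ⟨⟨j, j.2.trans_le h⟩, j.2⟩
      left_inv := fun _ ↦ rfl
      right_inv := fun _ ↦ rfl }

lemma finrank_fin_lt_add_finrank_fin_le :
    Module.finrank ℝ ({j : Fin n // j.val < k} → ℝ) +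
      Module.finrank ℝ ({j : Fin n // k ≤ j.val} → ℝ) =
      Module.finrank ℝ (EuclideanSpace ℝ (Fin n)) := by
  rw [← Module.finrank_prod]
  exact (EuclideanSpace.splitCoordinates n k).toLinearEquiv.finrank_eq

end SplitCoordinates

/-! ### Coordinate vector fields and derivatives of maps in charts -/

section Charts

variable {n k : ℕ} {M : Type*} [TopologicalSpace M] [ChartedSpace (EuclideanSpace ℝ (Fin n)) M]
  {φ : OpenPartialHomeomorph M (EuclideanSpace ℝ (Fin n))}

/-- The derivative of a chart, with values in Euclidean space. -/
noncomputable def OpenPartialHomeomorph.coordDeriv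
    (φ : OpenPartialHomeomorph M (EuclideanSpace ℝ (Fin n))) (q : M)
    (v : TangentSpace (𝓡 n) q) : EuclideanSpace ℝ (Fin n) :=
  mfderiv (𝓡 n) (𝓡 n) φ q v

/-- The span of the first `k` coordinate vector fields of a chart. -/
lemma mem_span_coordVectorField (hφ : φ ∈ IsManifold.maximalAtlas (𝓡 n) ∞ M) {q : M}
    (hq : q ∈ φ.source) (v : TangentSpace (𝓡 n) q) :
    v ∈ Submodule.span ℝ
      (Set.range fun j : {j : Fin n // j.val < k} ↦ coordVectorField φ j.val q) ↔
    ∀ j : {j : Fin n // k ≤ j.val}, φ.coordDeriv q v j.val = 0 := by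
  let L : TangentSpace (𝓡 n) q ≃L[ℝ] EuclideanSpace ℝ (Fin n) :=
    (IsManifold.mdifferentiable_of_mem_maximalAtlas hφ).mfderiv hq
  have hL : mfderiv (𝓡 n) (𝓡 n) φ q = (L : TangentSpace (𝓡 n) q →L[ℝ] EuclideanSpace ℝ (Fin n)) :=
    rfl
  have hcoord (j : Fin n) : coordVectorField φ j q = L.symm (EuclideanSpace.single j 1) := by
    change (mfderiv (𝓡 n) (𝓡 n) φ q).inverse _ = _
    rw [hL]
    exact DFunLike.congr_fun (ContinuousLinearMap.inverse_equiv L) _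
  have hsum (c : {j : Fin n // j.val < k} → ℝ) :
      (∑ i, c i • EuclideanSpace.single i.val (1 : ℝ)) =
        EuclideanSpace.splitCoordinates n k (c, 0) := by
    rw [← ContinuousLinearEquiv.symm_apply_eq, EuclideanSpace.splitCoordinates_symm_apply]
    ext j
    · simp [Pi.single_apply, Subtype.val_inj]
    · have (i : {j : Fin n // j.val < k}) : j.val ≠ i.val := fun h ↦ by
        have h1 := i.2
        have h2 := j.2
        rw [h] at h2
        omega
      simp [this]
  simp only [Submodule.mem_span_range_iff_exists_fun, hcoord, ← map_smul, ← map_sum, hsum]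
  change (∃ c, L.symm (EuclideanSpace.splitCoordinates n k (c, 0)) = v) ↔
    ∀ j : {j : Fin n // k ≤ j.val}, L v j.val = 0
  simp only [ContinuousLinearEquiv.symm_apply_eq]
  constructor
  · rintro ⟨c, hc⟩ j
    rw [← hc, EuclideanSpace.splitCoordinates_apply_of_le]; rfl
  · intro h
    refine ⟨fun j ↦ L v j.val, ?_⟩
    rw [← ContinuousLinearEquiv.eq_symm_apply, EuclideanSpace.splitCoordinates_symm_apply]
    ext j
    · rfl
    · exact (h j).symm

lemma IsManifold.trans_mem_maximalAtlas [IsManifold (𝓡 n) ∞ M]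
    (hφ : φ ∈ IsManifold.maximalAtlas (𝓡 n) ∞ M)
    {η : OpenPartialHomeomorph (EuclideanSpace ℝ (Fin n)) (EuclideanSpace ℝ (Fin n))}
    (hη : ContDiffOn ℝ ∞ η η.source) (hηsymm : ContDiffOn ℝ ∞ η.symm η.target) :
    φ.trans η ∈ IsManifold.maximalAtlas (𝓡 n) ∞ M := by
  refine (IsManifold.mem_maximalAtlas_iff_contMDiffOn _).2 ⟨?_, ?_⟩
  · exact hη.contMDiffOn.comp ((contMDiffOn_of_mem_maximalAtlas hφ).mono
      fun x hx ↦ hx.1) fun x hx ↦ hx.2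
  · exact (contMDiffOn_symm_of_mem_maximalAtlas hφ).comp (hηsymm.contMDiffOn.mono
      Set.inter_subset_left) Set.inter_subset_right

/-- The range of the derivative of a map of manifolds, computed in charts. -/
lemma mem_range_mfderiv_iff {m : ℕ} {N : Type*} [TopologicalSpace N]
    [ChartedSpace (EuclideanSpace ℝ (Fin m)) N] {i : N → M}
    {d : OpenPartialHomeomorph N (EuclideanSpace ℝ (Fin m))} (hd : d.MDifferentiable (𝓡 m) (𝓡 m))
    (hφ : φ.MDifferentiable (𝓡 n) (𝓡 n)) {u : EuclideanSpace ℝ (Fin m)} (hu : u ∈ d.target)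
    (hiu : i (d.symm u) ∈ φ.source) (hi : MDifferentiableAt (𝓡 m) (𝓡 n) i (d.symm u))
    {A : EuclideanSpace ℝ (Fin m) →L[ℝ] EuclideanSpace ℝ (Fin n)}
    (hA : HasFDerivAt (fun u ↦ φ (i (d.symm u))) A u) (v : TangentSpace (𝓡 n) (i (d.symm u))) :
    v ∈ (mfderiv (𝓡 m) (𝓡 n) i (d.symm u)).range ↔ ∃ s, A s = φ.coordDeriv (i (d.symm u)) v := by
  have hchain (s : EuclideanSpace ℝ (Fin m)) :
      φ.coordDeriv (i (d.symm u)) (mfderiv (𝓡 m) (𝓡 n) i (d.symm u)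
        (mfderiv (𝓡 m) (𝓡 m) d.symm u s)) = A s := by
    have h1 : HasMFDerivAt (𝓡 m) (𝓡 n) (fun u ↦ φ (i (d.symm u))) u _ :=
      (hφ.mdifferentiableAt hiu).hasMFDerivAt.comp u
        (hi.hasMFDerivAt.comp u (hd.mdifferentiableAt_symm hu).hasMFDerivAt)
    exact DFunLike.congr_fun (hasMFDerivAt_unique h1 hA.hasMFDerivAt) s
  constructor
  · rintro ⟨t, rfl⟩
    obtain ⟨s, rfl⟩ := (hd.symm.mfderiv hu).surjective t
    exact ⟨s, (hchain s).symm⟩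
  · rintro ⟨s, hs⟩
    exact ⟨mfderiv (𝓡 m) (𝓡 m) d.symm u s,
      (hφ.mfderiv hiu).injective ((hchain s).trans hs)⟩

end Charts

/-! ### Flat charts from involutivity -/

namespace TangentDistribution

variable {n k : ℕ} {M : Type*} [TopologicalSpace M] [ChartedSpace (EuclideanSpace ℝ (Fin n)) M]
  {D : TangentDistribution n k M} {φ : OpenPartialHomeomorph M (EuclideanSpace ℝ (Fin n))}

lemma le_of_mem (D : TangentDistribution n k M) (p : M) : k ≤ n := by
  have h : Module.finrank ℝ (TangentSpace (𝓡 n) p) = n := finrank_euclideanSpace_fin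
  rw [← D.finrank_eq p]
  have : FiniteDimensional ℝ (TangentSpace (𝓡 n) p) :=
    inferInstanceAs (FiniteDimensional ℝ (EuclideanSpace ℝ (Fin n)))
  exact (Submodule.finrank_le _).trans_eq h

lemma mfderiv_symm_inChart (hφ : φ ∈ IsManifold.maximalAtlas (𝓡 n) ∞ M)
    (X : (p : M) → TangentSpace (𝓡 n) p) {x : EuclideanSpace ℝ (Fin n)} (hx : x ∈ φ.target) :
    mfderiv (𝓡 n) (𝓡 n) φ.symm x (VectorField.inChart φ X x) = X (φ.symm x) := by
  have hd := IsManifold.mdifferentiable_of_mem_maximalAtlas hφ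
  have h := hd.symm_comp_deriv (φ.map_target hx)
  rw [φ.right_inv hx] at h
  rw [VectorField.inChart, VectorField.mpullback_apply, hd.inverse_mfderiv_symm hx]
  exact DFunLike.congr_fun h _

lemma inChart_mem (hφ : φ ∈ IsManifold.maximalAtlas (𝓡 n) ∞ M)
    {X : (p : M) → TangentSpace (𝓡 n) p} {x : EuclideanSpace ℝ (Fin n)} (hx : x ∈ φ.target) :
    VectorField.inChart φ X x ∈ D.inChart φ x ↔ X (φ.symm x) ∈ D.toFun (φ.symm x) := by
  rw [mem_inChart, mfderiv_symm_inChart hφ X hx]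

lemma inChart_eq_span (hφ : φ ∈ IsManifold.maximalAtlas (𝓡 n) ∞ M)
    {X : Fin k → (p : M) → TangentSpace (𝓡 n) p} {x : EuclideanSpace ℝ (Fin n)} (hx : x ∈ φ.target)
    (hX : D.toFun (φ.symm x) = Submodule.span ℝ (Set.range fun i ↦ X i (φ.symm x))) :
    D.inChart φ x = Submodule.span ℝ (Set.range fun i ↦ VectorField.inChart φ (X i) x) := by
  let L : EuclideanSpace ℝ (Fin n) ≃L[ℝ] TangentSpace (𝓡 n) (φ.symm x) :=
    (IsManifold.mdifferentiable_of_mem_maximalAtlas hφ).symm.mfderiv hx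
  ext w
  have h1 : w ∈ D.inChart φ x ↔ L w ∈ D.toFun (φ.symm x) := Iff.rfl
  have h2 (i : Fin k) : L (VectorField.inChart φ (X i) x) = X i (φ.symm x) :=
    mfderiv_symm_inChart hφ (X i) hx
  rw [h1, hX]
  simp only [Submodule.mem_span_range_iff_exists_fun, ← h2, ← map_smul, ← map_sum,
    L.injective.eq_iff]

variable [IsManifold (𝓡 n) ∞ M]

lemma contDiffOn_inChart (hφ : φ ∈ IsManifold.maximalAtlas (𝓡 n) ∞ M)
    {X : (p : M) → TangentSpace (𝓡 n) p} {U : Set M} (hU : IsOpen U)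
    (hX : SmoothVectorFieldOn X U) :
    ContDiffOn ℝ ∞ (VectorField.inChart φ X) (φ.target ∩ φ.symm ⁻¹' U) := by
  intro x hx
  refine ContDiffAt.contDiffWithinAt (contMDiffAt_vectorSpace_iff_contDiffAt.1 ?_)
  exact ContMDiffAt.mpullback_vectorField_preimage (n := ∞)
    (hX.contMDiffAt (hU.mem_nhds hx.2)) (contMDiffAt_symm_of_mem_maximalAtlas hφ hx.1)
    ((IsManifold.mdifferentiable_of_mem_maximalAtlas hφ).isInvertible_mfderiv_symm hx.1) (by simp)

/-- Frobenius' theorem: an involutive distribution has flat charts. -/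
theorem IsInvolutive.exists_isFlatChart [T2Space M] (hD : D.IsInvolutive) (hs : D.IsSmooth)
    (p : M) : ∃ φ : OpenPartialHomeomorph M (EuclideanSpace ℝ (Fin n)),
      p ∈ φ.source ∧ D.IsFlatChart φ := by
  let φ := chartAt (EuclideanSpace ℝ (Fin n)) p
  have hφ : φ ∈ IsManifold.maximalAtlas (𝓡 n) ∞ M := IsManifold.chart_mem_maximalAtlas p
  have hp : p ∈ φ.source := mem_chart_source _ p
  obtain ⟨U, hU, hpU, X, hX, hXD⟩ := hs p
  let O : Set (EuclideanSpace ℝ (Fin n)) := φ.target ∩ φ.symm ⁻¹' U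
  have hO : IsOpen O := φ.symm.isOpen_inter_preimage hU
  have hpO : φ p ∈ O := ⟨φ.map_source hp, by simpa [φ.left_inv hp] using hpU⟩
  obtain ⟨e, U', U'', hpe, heO, hetarget, he, hesymm, heD⟩ := exists_straightening (k := k)
    (D := D.inChart φ) (E := {j : Fin n // j.val < k} → ℝ) (F := {j : Fin n // k ≤ j.val} → ℝ)
    hO hpO (Y := fun i ↦ VectorField.inChart φ (X i)) (fun i ↦ contDiffOn_inChart hφ hU (hX i))
    (fun x hx ↦ inChart_eq_span hφ hx.1 (hXD _ hx.2)) (finrank_inChart hφ hpO.1)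
    (fun O' hO' hO'o V W hV hW hVD hWD x hx ↦ hD.lieBracket_mem_inChart hφ
      (hO'.trans Set.inter_subset_left) hO'o hV hW hVD hWD hx)
    (finrank_fin_lt (D.le_of_mem p)) finrank_fin_lt_add_finrank_fin_le
  let κ := EuclideanSpace.splitCoordinates n k
  let η : OpenPartialHomeomorph (EuclideanSpace ℝ (Fin n)) (EuclideanSpace ℝ (Fin n)) :=
    e.trans κ.toHomeomorph.toOpenPartialHomeomorph
  have hηs : η.source = e.source := by simp [η]
  have hηt : η.target = κ.symm ⁻¹' e.target := by simp [η]
  have hη : ContDiffOn ℝ ∞ η η.source := by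
    rw [hηs]; exact κ.contDiff.comp_contDiffOn he
  have hηsymm : ContDiffOn ℝ ∞ η.symm η.target := by
    rw [hηt]; exact hesymm.comp κ.symm.contDiff.contDiffOn (fun x hx ↦ hx)
  let χ := φ.trans η
  have hχs : χ.source = φ.source ∩ φ ⁻¹' e.source := by
    rw [OpenPartialHomeomorph.trans_source, hηs]
  have hχt : χ.target = κ.symm ⁻¹' (U' ×ˢ U'') := by
    rw [OpenPartialHomeomorph.trans_target, hηt, hetarget]
    -- Composing with `φ` loses nothing of the box, since `e.source ⊆ O ⊆ φ.target`.
    refine Set.inter_eq_left.2 fun x hx ↦ ?_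
    have : η.symm x ∈ η.source := η.map_target (by rw [hηt, hetarget]; exact hx)
    rw [hηs] at this
    exact (heO this).1
  have hχ : χ ∈ IsManifold.maximalAtlas (𝓡 n) ∞ M :=
    IsManifold.trans_mem_maximalAtlas hφ hη hηsymm
  refine ⟨χ, by rw [hχs]; exact ⟨hp, hpe⟩, hχ, ⟨U', U'', ?_⟩, fun q hq ↦ ?_⟩
  · rw [hχt]; rfl
  · have hq' := hq
    rw [hχs] at hq'
    obtain ⟨hqφ, hqe⟩ := hq'
    have hez : e (φ q) ∈ e.target := e.map_source hqe
    have hde : HasFDerivAt e (fderiv ℝ e (φ q)) (φ q) := ((he.contDiffAt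
      (e.open_source.mem_nhds hqe)).differentiableAt (by simp)).hasFDerivAt
    have hdes : HasFDerivAt e.symm (fderiv ℝ e.symm (e (φ q))) (e (φ q)) := ((hesymm.contDiffAt
      (e.open_target.mem_nhds hez)).differentiableAt (by simp)).hasFDerivAt
    have hleft (w : EuclideanSpace ℝ (Fin n)) :
        fderiv ℝ e.symm (e (φ q)) (fderiv ℝ e (φ q) w) = w := by
      have h1 : HasFDerivAt (fun x ↦ e.symm (e x)) _ (φ q) := hdes.comp (φ q) hde
      have h2 : HasFDerivAt (fun x ↦ e.symm (e x)) (ContinuousLinearMap.id ℝ _) (φ q) :=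
        (hasFDerivAt_id _).congr_of_eventuallyEq
          (Filter.eventuallyEq_of_mem (e.open_source.mem_nhds hqe) fun x hx ↦ e.left_inv hx)
      exact DFunLike.congr_fun (h1.unique h2) w
    have hright (w) : fderiv ℝ e (φ q) (fderiv ℝ e.symm (e (φ q)) w) = w := by
      have hde' : HasFDerivAt e (fderiv ℝ e (φ q)) (e.symm (e (φ q))) := by
        rwa [e.left_inv hqe]
      have h1 : HasFDerivAt (fun x ↦ e (e.symm x)) _ (e (φ q)) := hde'.comp (e (φ q)) hdes
      have h2 : HasFDerivAt (fun x ↦ e (e.symm x)) (ContinuousLinearMap.id ℝ _) (e (φ q)) :=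
        (hasFDerivAt_id _).congr_of_eventuallyEq
          (Filter.eventuallyEq_of_mem (e.open_target.mem_nhds hez) fun x hx ↦ e.right_inv hx)
      exact DFunLike.congr_fun (h1.unique h2) w
    have hdχ (v : EuclideanSpace ℝ (Fin n)) :
        χ.coordDeriv q v = κ (fderiv ℝ e (φ q) (φ.coordDeriv q v)) := by
      have h1 : HasMFDerivAt (𝓡 n) (𝓡 n) η (φ q)
          ((κ : _ →L[ℝ] EuclideanSpace ℝ (Fin n)).comp (fderiv ℝ e (φ q))) :=
        (κ.hasFDerivAt.comp (φ q) hde).hasMFDerivAt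
      have h2 := h1.comp q ((IsManifold.mdifferentiable_of_mem_maximalAtlas hφ).mdifferentiableAt
        hqφ).hasMFDerivAt
      exact DFunLike.congr_fun h2.mfderiv v
    -- In the chart, `D` is the image of the first factor under the derivative of `e.symm`. As
    -- `hleft` and `hright` make the two derivatives inverse, a vector lies in `D` iff the
    -- derivative of `e` sends it to one with zero second component.
    have hDq := heD _ hez
    rw [e.left_inv hqe] at hDq
    ext v
    rw [mem_span_coordVectorField hχ hq]
    refine (mfderiv_mem_inChart hφ hqφ v).symm.trans ?_
    change φ.coordDeriv q v ∈ (D.inChart φ (φ q) : Set (EuclideanSpace ℝ (Fin n))) ↔ _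
    rw [hDq]
    have hcoord (j : {j : Fin n // k ≤ j.val}) :
        χ.coordDeriv q v j.val = (fderiv ℝ e (φ q) (φ.coordDeriv q v)).2 j :=
      (congrArg (fun w : EuclideanSpace ℝ (Fin n) ↦ w j.val) (hdχ v)).trans
        (EuclideanSpace.splitCoordinates_apply_of_le _ j)
    constructor
    · rintro ⟨u, hu⟩ j
      exact (hcoord j).trans (by rw [← hu, hright]; rfl)
    · intro h
      refine ⟨(fderiv ℝ e (φ q) (φ.coordDeriv q v)).1, ?_⟩
      have h0 : (fderiv ℝ e (φ q) (φ.coordDeriv q v)).2 = 0 := by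
        ext j
        exact (hcoord j).symm.trans (h j)
      rw [← h0]
      exact hleft _

end TangentDistribution

/-! ### Brackets of fields tangent to a linear subspace -/

section

variable {E F G : Type*} [NormedAddCommGroup E] [NormedSpace ℝ E] [NormedAddCommGroup F]
  [NormedSpace ℝ F] [NormedAddCommGroup G] [NormedSpace ℝ G]

/-- A linear map that vanishes on a vector field along a linear subspace vanishes on its
derivatives along the subspace. -/
lemma map_fderiv_eq_zero_of_eventually {ι : E →L[ℝ] G} {π : G →L[ℝ] F} {V : G → G} {u : E}
    (hV : DifferentiableAt ℝ V (ι u)) (h : ∀ᶠ u' in nhds u, π (V (ι u')) = 0) (s : E) :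
    π (fderiv ℝ V (ι u) (ι s)) = 0 := by
  have h1 : HasFDerivAt (fun u' ↦ π (V (ι u'))) (π.comp ((fderiv ℝ V (ι u)).comp ι)) u :=
    π.hasFDerivAt.comp u (hV.hasFDerivAt.comp u ι.hasFDerivAt)
  have h2 : HasFDerivAt (fun u' ↦ π (V (ι u'))) (0 : E →L[ℝ] F) u :=
    (hasFDerivAt_const (0 : F) u).congr_of_eventuallyEq h
  exact DFunLike.congr_fun (h1.unique h2) s

/-- Vector fields that are tangent to a linear subspace have a Lie bracket tangent to it. -/
lemma map_lieBracket_eq_zero_of_eventually {ι : E →L[ℝ] G} {π : G →L[ℝ] F}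
    (hπ : ∀ w, π w = 0 → ∃ s, ι s = w) {V W : G → G} {u : E}
    (hV : DifferentiableAt ℝ V (ι u)) (hW : DifferentiableAt ℝ W (ι u))
    (hVπ : ∀ᶠ u' in nhds u, π (V (ι u')) = 0) (hWπ : ∀ᶠ u' in nhds u, π (W (ι u')) = 0) :
    π (VectorField.lieBracket ℝ V W (ι u)) = 0 := by
  -- Both fields are tangent to the subspace at `ι u`, so each term of the bracket differentiates
  -- along the subspace.
  obtain ⟨s, hs⟩ := hπ _ hVπ.self_of_nhds
  obtain ⟨t, ht⟩ := hπ _ hWπ.self_of_nhds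
  rw [VectorField.lieBracket, map_sub, ← hs, ← ht, map_fderiv_eq_zero_of_eventually hV hVπ,
    map_fderiv_eq_zero_of_eventually hW hWπ, sub_zero]

end

/-! ### Involutivity from integral manifolds -/

namespace TangentDistribution

open Manifold

variable {n k m : ℕ} {M : Type*} [TopologicalSpace M] [ChartedSpace (EuclideanSpace ℝ (Fin n)) M]
  {D : TangentDistribution n k M} {N : Type*} [TopologicalSpace N]
  [ChartedSpace (EuclideanSpace ℝ (Fin m)) N]

/-- In charts in which an integral manifold is linear, the distribution is constant along it. -/
lemma IsIntegralManifold.mem_inChart_iff [IsManifold (𝓡 n) ∞ M] [IsManifold (𝓡 m) ∞ N]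
    {i : N → M} (hi : D.IsIntegralManifold (m := m) i)
    {F : Type*} [NormedAddCommGroup F] [NormedSpace ℝ F] {q : N}
    (h : IsImmersionAtOfComplement F (𝓡 m) (𝓡 n) ∞ i q)
    {u : EuclideanSpace ℝ (Fin m)} (hu : u ∈ h.domChart.target) (w : EuclideanSpace ℝ (Fin n)) :
    w ∈ D.inChart h.codChart (h.equiv (u, 0)) ↔ (h.equiv.symm w).2 = 0 := by
  have hd := IsManifold.mdifferentiable_of_mem_maximalAtlas h.domChart_mem_maximalAtlas
  have hc := IsManifold.mdifferentiable_of_mem_maximalAtlas h.codChart_mem_maximalAtlas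
  have hcoord (u : EuclideanSpace ℝ (Fin m)) (hu : u ∈ h.domChart.target) :
      h.codChart (i (h.domChart.symm u)) = h.equiv (u, 0) :=
    h.writtenInCharts (by simpa using hu)
  have hiu : i (h.domChart.symm u) ∈ h.codChart.source :=
    h.source_subset_preimage_source (h.domChart.map_target hu)
  have hid : MDifferentiableAt (𝓡 m) (𝓡 n) i (h.domChart.symm u) :=
    (hi.isImmersion.contMDiff).mdifferentiable (by simp) _
  -- In these charts `i` is `u ↦ h.equiv (u, 0)`, so the image of its derivative, which is `D` read
  -- in the chart, is the fixed subspace `h.equiv (· , 0)`.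
  have hA : HasFDerivAt (fun u ↦ h.codChart (i (h.domChart.symm u)))
      ((h.equiv : _ →L[ℝ] EuclideanSpace ℝ (Fin n)).comp (ContinuousLinearMap.inl ℝ _ F)) u :=
    ((h.equiv : _ →L[ℝ] EuclideanSpace ℝ (Fin n)).comp
      (ContinuousLinearMap.inl ℝ _ F)).hasFDerivAt.congr_of_eventuallyEq
      (Filter.eventuallyEq_of_mem (h.domChart.open_target.mem_nhds hu) fun u hu ↦ hcoord u hu)
  obtain ⟨v, hv⟩ : ∃ v, h.codChart.coordDeriv (i (h.domChart.symm u)) v = w :=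
    (hc.mfderiv hiu).surjective w
  rw [← hcoord u hu, ← hv]
  refine (mfderiv_mem_inChart h.codChart_mem_maximalAtlas hiu v).trans ?_
  rw [← hi.range_mfderiv]
  refine (mem_range_mfderiv_iff hd hc hu hiu hid hA v).trans ⟨?_, fun h0 ↦
    ⟨(h.equiv.symm (h.codChart.coordDeriv (i (h.domChart.symm u)) v)).1, ?_⟩⟩
  · rintro ⟨s, hs⟩
    rw [← hs]
    simp
  · change h.equiv (_, 0) = _
    rw [← h0]
    exact h.equiv.apply_symm_apply _

/-- A distribution with an integral manifold through every point is involutive. -/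
theorem IsCompletelyIntegrable.isInvolutive [IsManifold (𝓡 n) ∞ M]
    (hD : D.IsCompletelyIntegrable) : D.IsInvolutive := by
  intro X Y hX hY hXD hYD p
  obtain ⟨m, N, _, _, _, _, _, i, hi, q, rfl⟩ := hD p
  have h : IsImmersionAtOfComplement hi.isImmersion.complement (𝓡 m) (𝓡 n) ∞ i q :=
    hi.isImmersion.isImmersionOfComplement_complement q
  have hφ := h.codChart_mem_maximalAtlas
  let u := h.domChart q
  have hu : u ∈ h.domChart.target := h.domChart.map_source h.mem_domChart_source
  have hx : h.codChart (i q) = h.equiv (u, 0) := by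
    have := h.writtenInCharts (show u ∈ (h.domChart.extend (𝓡 m)).target by simpa using hu)
    simpa [u, h.domChart.left_inv h.mem_domChart_source] using this
  have hxt : h.equiv (u, 0) ∈ h.codChart.target := by
    rw [← hx]; exact h.codChart.map_source h.mem_codChart_source
  let ι : EuclideanSpace ℝ (Fin m) →L[ℝ] EuclideanSpace ℝ (Fin n) :=
    (h.equiv : _ →L[ℝ] EuclideanSpace ℝ (Fin n)).comp
      (ContinuousLinearMap.inl ℝ _ hi.isImmersion.complement)
  -- The kernel of `π` is the range of `ι`, which is `D` read in the chart at the points `ι u'` with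
  -- `u'` near `u`.
  let π : EuclideanSpace ℝ (Fin n) →L[ℝ] hi.isImmersion.complement :=
    (ContinuousLinearMap.snd ℝ (EuclideanSpace ℝ (Fin m)) hi.isImmersion.complement).comp
      (h.equiv.symm : EuclideanSpace ℝ (Fin n) →L[ℝ] _)
  have hdiff {X : (p : M) → TangentSpace (𝓡 n) p} (hX : SmoothVectorFieldOn X Set.univ) :
      DifferentiableAt ℝ (VectorField.inChart h.codChart X) (ι u) :=
    ((contDiffOn_inChart hφ isOpen_univ hX).contDiffAt
      ((h.codChart.open_target.inter (by simp)).mem_nhds ⟨hxt, trivial⟩)).differentiableAt (by simp)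
  have hzero {X : (p : M) → TangentSpace (𝓡 n) p} (hXD : ∀ p, X p ∈ D.toFun p) :
      ∀ᶠ u' in nhds u, π (VectorField.inChart h.codChart X (ι u')) = 0 := by
    have hc : ∀ᶠ u' in nhds u, ι u' ∈ h.codChart.target :=
      ι.continuous.continuousAt.eventually (h.codChart.open_target.mem_nhds hxt)
    filter_upwards [h.domChart.open_target.mem_nhds hu, hc] with u' hu' hcu'
    exact (hi.mem_inChart_iff h hu' _).1 ((inChart_mem hφ hcu').2 (hXD _))
  have hbr := map_lieBracket_eq_zero_of_eventually (π := π) (ι := ι) (fun w hw ↦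
    ⟨(h.equiv.symm w).1, by
      have : (h.equiv.symm w).2 = 0 := hw
      change h.equiv ((h.equiv.symm w).1, 0) = w
      rw [← this]
      exact h.equiv.apply_symm_apply w⟩) (hdiff hX) (hdiff hY) (hzero hXD) (hzero hYD)
  have hmem := (hi.mem_inChart_iff h hu _).2 hbr
  have hb := mfderiv_symm_lieBracket hφ hX hY hxt
  have hp : h.codChart.symm (h.equiv (u, 0)) = i q := by
    rw [← hx, h.codChart.left_inv h.mem_codChart_source]
  rw [mem_inChart] at hmem
  have := hb ▸ hmem
  rwa [hp] at this

end TangentDistribution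

/-! ### Slices of a chart -/

section Slice

variable {n k : ℕ} {M : Type*} [TopologicalSpace M]

/-- The level set of the last coordinates of a chart. -/
def OpenPartialHomeomorph.slice (k : ℕ)
    (φ : OpenPartialHomeomorph M (EuclideanSpace ℝ (Fin n)))
    (c : {j : Fin n // k ≤ j.val} → ℝ) : Set M :=
  {q | q ∈ φ.source ∧ ((EuclideanSpace.splitCoordinates n k).symm (φ q)).2 = c}

variable (φ : OpenPartialHomeomorph M (EuclideanSpace ℝ (Fin n)))
  (c : {j : Fin n // k ≤ j.val} → ℝ)

lemma OpenPartialHomeomorph.splitCoordinates_of_mem_slice {q : M} (hq : q ∈ φ.slice k c) :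
    EuclideanSpace.splitCoordinates n k
      (((EuclideanSpace.splitCoordinates n k).symm (φ q)).1, c) = φ q := by
  rw [← hq.2]
  exact ContinuousLinearEquiv.apply_symm_apply _ _

open Classical in
/-- The first coordinates as a chart on a slice. -/
noncomputable def OpenPartialHomeomorph.sliceChart (q₀ : φ.slice k c) {E : Type*}
    [NormedAddCommGroup E] [NormedSpace ℝ E] (τ : ({j : Fin n // j.val < k} → ℝ) ≃L[ℝ] E) :
    OpenPartialHomeomorph (φ.slice k c) E where
  toFun q := τ ((EuclideanSpace.splitCoordinates n k).symm (φ q.val)).1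
  -- `q₀` is only a default value outside the target.
  invFun w := if h : EuclideanSpace.splitCoordinates n k (τ.symm w, c) ∈ φ.target then
    ⟨φ.symm (EuclideanSpace.splitCoordinates n k (τ.symm w, c)), φ.map_target h, by
      rw [φ.right_inv h, ContinuousLinearEquiv.symm_apply_apply]⟩ else q₀
  -- The chart covers the whole slice, so by itself it makes the slice a manifold.
  source := Set.univ
  target := {w | EuclideanSpace.splitCoordinates n k (τ.symm w, c) ∈ φ.target}
  map_source' q _ := by
    simpa [φ.splitCoordinates_of_mem_slice c q.2] using φ.map_source q.2.1
  map_target' _ _ := trivial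
  left_inv' q _ := by
    refine Subtype.ext ?_
    simp [φ.splitCoordinates_of_mem_slice c q.2, φ.map_source q.2.1, φ.left_inv q.2.1]
  right_inv' w hw := by
    have hw' : EuclideanSpace.splitCoordinates n k (τ.symm w, c) ∈ φ.target := hw
    simp [hw', φ.right_inv hw']
  open_source := isOpen_univ
  open_target := φ.open_target.preimage (by fun_prop)
  continuousOn_toFun := by
    have h : ContinuousOn (fun q : φ.slice k c ↦ φ q.val) Set.univ :=
      φ.continuousOn.comp continuous_subtype_val.continuousOn fun q _ ↦ q.2.1
    exact τ.continuous.comp_continuousOn (continuous_fst.comp_continuousOn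
      ((EuclideanSpace.splitCoordinates n k).symm.continuous.comp_continuousOn h))
  continuousOn_invFun := by
    refine (Topology.IsInducing.subtypeVal).continuousOn_iff.2 ?_
    refine ContinuousOn.congr (f := fun w ↦
      φ.symm (EuclideanSpace.splitCoordinates n k (τ.symm w, c))) ?_ fun w hw ↦ ?_
    · exact φ.continuousOn_symm.comp (by fun_prop) fun w hw ↦ hw
    · exact congrArg Subtype.val (dif_pos hw)

variable {φ c} (q₀ : φ.slice k c) {E : Type*} [NormedAddCommGroup E] [NormedSpace ℝ E]
  (τ : ({j : Fin n // j.val < k} → ℝ) ≃L[ℝ] E)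

lemma OpenPartialHomeomorph.apply_sliceChart_symm {w : E}
    (hw : w ∈ (φ.sliceChart c q₀ τ).target) :
    φ ((φ.sliceChart c q₀ τ).symm w).val = EuclideanSpace.splitCoordinates n k (τ.symm w, c) := by
  have h : (φ.sliceChart c q₀ τ).symm w = _ := dif_pos hw
  rw [h]
  exact φ.right_inv hw

end Slice

/-! ### Slices of flat charts as integral manifolds -/

namespace TangentDistribution

open Manifold

variable {n k : ℕ} {M : Type*} [TopologicalSpace M] [ChartedSpace (EuclideanSpace ℝ (Fin n)) M]
  {D : TangentDistribution n k M}

/-- A distribution with flat charts is completely integrable: the slices are integral manifolds. -/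
theorem isCompletelyIntegrable_of_isFlatChart [T2Space M] [SecondCountableTopology M]
    [IsManifold (𝓡 n) ∞ M] (hD : ∀ p : M,
      ∃ φ : OpenPartialHomeomorph M (EuclideanSpace ℝ (Fin n)), p ∈ φ.source ∧ D.IsFlatChart φ) :
    D.IsCompletelyIntegrable := by
  intro p
  obtain ⟨φ, hp, hφD⟩ := hD p
  have hφ := hφD.mem_maximalAtlas
  let κ := EuclideanSpace.splitCoordinates n k
  let c := (κ.symm (φ p)).2
  let q₀ : φ.slice k c := ⟨p, hp, rfl⟩
  let τ : ({j : Fin n // j.val < k} → ℝ) ≃L[ℝ] EuclideanSpace ℝ (Fin k) :=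
    ContinuousLinearEquiv.ofFinrankEq (by rw [finrank_fin_lt (D.le_of_mem p)]; simp)
  let d := φ.sliceChart c q₀ τ
  let : ChartedSpace (EuclideanSpace ℝ (Fin k)) (φ.slice k c) := d.singletonChartedSpace rfl
  have : IsManifold (𝓡 k) ∞ (φ.slice k c) := d.isManifold_singleton rfl
  have hd : d ∈ IsManifold.maximalAtlas (𝓡 k) ∞ (φ.slice k c) :=
    IsManifold.chart_mem_maximalAtlas q₀
  let ε : (EuclideanSpace ℝ (Fin k) × ({j : Fin n // k ≤ j.val} → ℝ)) ≃L[ℝ]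
      EuclideanSpace ℝ (Fin n) :=
    (τ.symm.prodCongr (ContinuousLinearEquiv.refl ℝ _)).trans κ
  -- Translating the slice value `c` to `0` puts the inclusion in the normal form `w ↦ ε (w, 0)` of
  -- an immersion.
  let η := (Homeomorph.subRight (κ (0, c))).toOpenPartialHomeomorph
  have hχ : φ.trans η ∈ IsManifold.maximalAtlas (𝓡 n) ∞ M :=
    IsManifold.trans_mem_maximalAtlas hφ (contDiff_id.sub contDiff_const).contDiffOn
      (contDiff_id.add contDiff_const).contDiffOn
  have hval : Continuous (Subtype.val : φ.slice k c → M) := continuous_subtype_val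
  have himm : IsImmersion (𝓡 k) (𝓡 n) ∞ (Subtype.val : φ.slice k c → M) := by
    refine IsImmersionOfComplement.isImmersion (F := {j : Fin n // k ≤ j.val} → ℝ) fun q ↦ ?_
    refine IsImmersionAtOfComplement.mk_of_continuousAt hval.continuousAt ε d (φ.trans η)
      trivial ⟨q.2.1, trivial⟩ hd hχ fun w hw ↦ ?_
    have hw' : w ∈ d.target := by simpa using hw
    change φ (d.symm w).val - κ (0, c) = κ (τ.symm w, 0)
    rw [φ.apply_sliceChart_symm q₀ τ hw', ← map_sub]
    simp [κ]
  refine ⟨k, φ.slice k c, inferInstance, inferInstance, inferInstance, inferInstance, inferInstance,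
    Subtype.val, ⟨Subtype.val_injective, himm, fun q ↦ ?_⟩, ⟨q₀, rfl⟩⟩
  have hu : d q ∈ d.target := d.map_source trivial
  have hq : d.symm (d q) = q := d.left_inv trivial
  rw [← hq]
  ext v
  let A : EuclideanSpace ℝ (Fin k) →L[ℝ] EuclideanSpace ℝ (Fin n) :=
    (ε : _ →L[ℝ] EuclideanSpace ℝ (Fin n)).comp
      (ContinuousLinearMap.inl ℝ _ ({j : Fin n // k ≤ j.val} → ℝ))
  have hA : HasFDerivAt (fun w ↦ φ (d.symm w).val) A (d q) := by
    have h1 : HasFDerivAt (fun w ↦ A w + κ (0, c)) A (d q) := A.hasFDerivAt.add_const _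
    refine h1.congr_of_eventuallyEq (Filter.eventuallyEq_of_mem (d.open_target.mem_nhds hu)
      fun w hw ↦ (φ.apply_sliceChart_symm q₀ τ hw).trans ?_)
    change _ = κ (τ.symm w, 0) + κ (0, c)
    rw [← map_add]
    simp [κ]
  refine (mem_range_mfderiv_iff (IsManifold.mdifferentiable_of_mem_maximalAtlas hd)
    (IsManifold.mdifferentiable_of_mem_maximalAtlas hφ) hu (d.symm (d q)).2.1
    (himm.contMDiff.mdifferentiable (by simp) _) hA v).trans ?_
  rw [hφD.eq_span _ (d.symm (d q)).2.1, mem_span_coordVectorField hφ (d.symm (d q)).2.1]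
  constructor
  · rintro ⟨s, hs⟩ j
    rw [← hs]
    exact EuclideanSpace.splitCoordinates_apply_of_le (τ.symm s, 0) j
  · intro h
    refine ⟨τ (κ.symm (φ.coordDeriv (d.symm (d q)).val v)).1, ?_⟩
    change κ (τ.symm (τ _), 0) = _
    rw [τ.symm_apply_apply, ← ContinuousLinearEquiv.eq_symm_apply]
    exact Prod.ext rfl (funext fun j ↦ (h j).symm)

end TangentDistribution

/-! ### Frobenius' theorem -/

theorem mainTheorem3 {n k : ℕ} {M : Type*} [TopologicalSpace M] [T2Space M]
    [SecondCountableTopology M] [ChartedSpace (EuclideanSpace ℝ (Fin n)) M]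
    [IsManifold (𝓡 n) ∞ M] (D : TangentDistribution n k M) (hD : D.IsSmooth) :
    List.TFAE [
      ∀ p : M, ∃ φ : OpenPartialHomeomorph M (EuclideanSpace ℝ (Fin n)),
        p ∈ φ.source ∧ D.IsFlatChart φ,
      D.IsCompletelyIntegrable,
      D.IsInvolutive] := by
  tfae_have 1 → 2 := TangentDistribution.isCompletelyIntegrable_of_isFlatChart
  tfae_have 2 → 3 := TangentDistribution.IsCompletelyIntegrable.isInvolutive
  tfae_have 3 → 1 := fun h ↦ h.exists_isFlatChart hD
  tfae_finish
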